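/- **Setting.** Let $T$ be a finite set (primitive tests) and let $\mathsf{Act}$, $\mathsf{Out}$ be sets. Tests are generated by $b,c ::= 0 \mid 1 \mid t\in T \mid b+c \mid bc \mid \bar b$; $b\equiv_{\mathsf{BA}}c$ denotes Boolean equivalence and $\mathsf{At}$ is the set of atoms of the free Boolean algebra on $T$ (equivalently, truth assignments on $T$); for an atom $\alpha$ and a test $b$ exactly one of $\alpha\le b$, $\alpha\le\bar b$ holds. ProbGKAT expressions $\mathsf{Exp}$ are generated by $$e,f ::= p\in\mathsf{Act}\mid b\mid e+_b f\mid e;f\mid e^{(b)}\mid v\in\mathsf{Out}\mid e\oplus_r f\mid e^{[r]}\qquad (b \text{ a test},\ r\in[0,1]).$$ **Automata and bisimilarity.** Let $\mathcal D_\omega(Y)$ be the set of finitely supported probability distributions on $Y$, $\delta_y$ the point mass at $y$, and $\nu[A]=\sum_{y\in A}\nu(y)$. Let $2=\{\times,\checkmark\}$. A ProbGKAT automaton is a set $X$ with a map $\beta:X\times\mathsf{At}\to\mathcal D_\omega(2+\mathsf{Out}+\mathsf{Act}\times X)$. A homomorphism $(X,\beta)\to(Y,\gamma)$ is a map $h:X\to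 Y$ with $\gamma(h(x))_\alpha(o)=\beta(x)_\alpha(o)$ for $o\in 2+\mathsf{Out}$ and $\gamma(h(x))_\alpha(p,y)=\beta(x)_\alpha[\{p\}\times h^{-1}(y)]$. A relation $R\subseteq X\times Y$ is a bisimulation if there is an automaton structure on $R$ making both projections homomorphisms. States are bisimilar, $x\sim y$, if some bisimulation relates them. **The Brzozowski automaton** $(\mathsf{Exp},\partial)$: $\partial(p)_\alpha=\delta_{(p,1)}$; $\partial(v)_\alpha=\delta_v$; $\partial(b)_\alpha=\delta_\checkmark$ if $\alpha\le b$ and $\delta_\times$ otherwise; $\partial(e+_bf)_\alpha=\partial(e)_\alpha$ if $\alpha\le b$ and $\partial(f)_\alpha$ otherwise; $\partial(e\oplus_rf)_\alpha=r\,\partial(e)_\alpha+(1-r)\,\partial(f)_\alpha$; $\partial(e;f)_\alpha=\sum_d\partial(e)_\alpha(d)\,c(d)$, where $c(\checkmark)=\partial(f)_\alpha$, $c(d)=\delta_d$ for $d\in\{\times\}\cup\mathsf{Out}$, and $c(p,e')=\delta_{(p,\,e';f)}$. For loops put $t=\partial(e)_\alpha(\checkmark)$. If $rt=1$ then $\partial(e^{[r]})_\alpha=\delta_\times$;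 otherwise $\partial(e^{[r]})_\alpha$ assigns $\frac{1-r}{1-rt}$ to $\checkmark$, $\frac{r\,\partial(e)_\alpha(d)}{1-rt}$ to $d\in\{\times\}\cup\mathsf{Out}$, $\frac{r\,\partial(e)_\alpha(p,e')}{1-rt}$ to $(p,\,e';e^{[r]})$, and $0$ to everything else. If $\alpha\le\bar b$ then $\partial(e^{(b)})_\alpha=\delta_\checkmark$. If $\alpha\le b$ and $t=1$ then $\partial(e^{(b)})_\alpha=\delta_\times$. If $\alpha\le b$ and $t<1$, then $\partial(e^{(b)})_\alpha$ assigns $\frac{\partial(e)_\alpha(d)}{1-t}$ to $d\in\{\times\}\cup\mathsf{Out}$, $\frac{\partial(e)_\alpha(p,e')}{1-t}$ to $(p,\,e';e^{(b)})$, and $0$ to everything else. **Axioms.** Define $\mathsf E(e)_\alpha\in[0,1]$ by $\mathsf E(p)_\alpha=\mathsf E(v)_\alpha=0$; $\mathsf E(b)_\alpha=1$ if $\alpha\le b$, else $0$; $\mathsf E(e+_bf)_\alpha=\mathsf E(e)_\alpha$ if $\alpha\le b$, else $\mathsf E(f)_\alpha$; $\mathsf E(e\oplus_rf)_\alpha=r\mathsf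 E(e)_\alpha+(1-r)\mathsf E(f)_\alpha$; $\mathsf E(e;f)_\alpha=\mathsf E(e)_\alpha\mathsf E(f)_\alpha$; $\mathsf E(e^{(b)})_\alpha=\mathsf E(\bar b)_\alpha$; $\mathsf E(e^{[r]})_\alpha=0$ if $r=1$ and $\mathsf E(e)_\alpha=1$, else $\frac{1-r}{1-r\mathsf E(e)_\alpha}$. Write $\mathsf E(e)=0$ if $\mathsf E(e)_\alpha=0$ for all $\alpha$. Let $\equiv$ be the least congruence on $\mathsf{Exp}$ (with respect to $+_b$, $;$, $(-)^{(b)}$, $\oplus_r$, $(-)^{[r]}$), in which tests, also as guards, are taken up to $\equiv_{\mathsf{BA}}$, satisfying for all expressions $e,f,g$, tests $b,c$, $v\in\mathsf{Out}$ and $r,s\in[0,1]$ (whenever the denominators are non-zero): - (G1) $e+_be\equiv e$; (G2) $e+_bf\equiv b;e+_bf$; (G3) $e+_bf\equiv f+_{\bar b}e$; (G4) $(e+_bf)+_cg\equiv e+_{bc}(f+_cg)$; - (D) $e\oplus_r(f+_bg)\equiv(e\oplus_rf)+_b(e\oplus_rg)$; - (S1) $1;e\equiv e$; (S2) $e;1\equiv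 e$; (S3) $(e;f);g\equiv e;(f;g)$; (S4) $0;e\equiv0$; (S5) $(e+_bf);g\equiv e;g+_bf;g$; (S6) $(e\oplus_rf);g\equiv e;g\oplus_rf;g$; (S7) $v;e\equiv v$; (S8) $b;c\equiv bc$; - (L1) $e^{(b)}\equiv e;e^{(b)}+_b1$; (L2) $e^{[r]}\equiv e;e^{[r]}\oplus_r1$; (L3) $(e+_c1)^{(b)}\equiv(c;e)^{(b)}$; (L4) $e^{(1)}\equiv e^{[1]}$; - (L5) if $e\equiv(f\oplus_s1)+_cg$ and $s>0$, then $c;e^{(b)}\equiv c;(f;e^{(b)}+_b1)$; (L6) if $e\equiv(f\oplus_s1)+_cg$, then $c;e^{[r]}\equiv c;(f;e^{[r]}\oplus_{\frac{rs}{1-r(1-s)}}1)$; - (P1) $e\oplus_re\equiv e$; (P2) $e\oplus_1f\equiv e$; (P3) $e\oplus_rf\equiv f\oplus_{1-r}e$; (P4) $(e\oplus_rf)\oplus_sg\equiv e\oplus_{rs}(f\oplus_{\frac{(1-r)s}{1-rs}}g)$; - (F1) if $g\equiv e;g+_bf$ and $\mathsf E(e)=0$, then $g\equiv e^{(b)};f$;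 (F2) if $g\equiv e;g\oplus_rf$ and $\mathsf E(e)=0$, then $g\equiv e^{[r]};f$. **Uniqueness axiom.** For a finite set $X$ of indeterminates, let $\mathsf{PExp}(X)$ be generated by $p_1,p_2::=f\mid gx\mid p_1\oplus_rp_2$ and $\mathsf{Exp}(X)$ by $e_1,e_2::=p\mid e_1+_be_2$, with $f,g\in\mathsf{Exp}$, $x\in X$, $p\in\mathsf{PExp}(X)$. A system $\tau:X\to\mathsf{Exp}(X)$ is Salomaa if $\mathsf E(g)=0$ for every subterm $gx$ of every $\tau(x)$. For $h:X\to\mathsf{Exp}$, $h^\#(e)$ is obtained from $e\in\mathsf{Exp}(X)$ by replacing each $gx$ by $g;h(x)$. The map $h$ is a solution of $\tau$ up to a relation $R$ if $(h(x),h^\#(\tau(x)))\in R$ for all $x\in X$. Let $\mathrel{\dot\equiv}$ be the least congruence on $\mathsf{Exp}$ that contains $\equiv$ and satisfies (UA): whenever $h,k$ are solutions up to $\mathrel{\dot\equiv}$ of a Salomaa system $\tau$ on a finite set $X$, then $h(x)\mathrel{\dot\equiv}k(x)$ for all $x\in X$. **Theorem (Completeness).** For all $e,f\in\mathsf{Exp}$: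 if $e\sim f$ in the Brzozowski automaton $(\mathsf{Exp},\partial)$, then $e\mathrel{\dot\equiv}f$. -/

import Mathlib

noncomputable section

namespace ProbGKAT

open Convexity
open scoped unitInterval

universe u v w x y

/-! ### Boolean tests -/

/-- Boolean tests over the primitive tests `T`. -/
inductive BExp (T : Type u) : Type u
  | zero : BExp T
  | one : BExp T
  | prim (t : T) : BExp T
  | or (b c : BExp T) : BExp T
  | and (b c : BExp T) : BExp T
  | not (b : BExp T) : BExp T

/-- Atoms, represented as truth assignments to the primitive tests. As `T` is finite, the free
Boolean algebra on `T` is the algebra of all sets of truth assignments (every such set is denoted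
by a test, see `BExp.exists_denotes`), and its minimal non-zero elements are the singletons. -/
abbrev At (T : Type u) : Type u := T → Bool

namespace BExp

variable {T : Type u}

/-- The truth value of a test under a truth assignment. -/
def eval (α : At T) : BExp T → Bool
  | zero => false
  | one => true
  | prim t => α t
  | or b c => b.eval α || c.eval α
  | and b c => b.eval α && c.eval α
  | not b => !b.eval α

/-- Boolean equivalence of tests, `b ≡_BA c`. -/
def BAEquiv (b c : BExp T) : Prop := ∀ α : At T, b.eval α = c.eval α

/-- `b.Holds α` is the entailment `α ≤_BA b` of a test by an atom; its negation is
`α ≤_BA b̄`, see `holds_not`. -/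
def Holds (b : BExp T) (α : At T) : Prop := b.eval α = true

instance (b : BExp T) (α : At T) : Decidable (b.Holds α) := by
  unfold Holds; infer_instance

theorem holds_not (b : BExp T) (α : At T) : b.not.Holds α ↔ ¬ b.Holds α := by
  simp [Holds, eval]

theorem exists_denotes_atom [Finite T] (α : At T) :
    ∃ b : BExp T, ∀ β : At T, b.Holds β ↔ β = α := by
  classical
  cases nonempty_fintype T
  have key : ∀ s : Finset T, ∃ b : BExp T, ∀ β : At T, b.Holds β ↔ ∀ t ∈ s, β t = α t := by
    intro s
    induction s using Finset.induction_on with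
    | empty => exact ⟨one, fun β => by simp [Holds, eval]⟩
    | insert t s _ ih =>
      obtain ⟨b, hb⟩ := ih
      refine ⟨and (if α t = true then prim t else not (prim t)) b, fun β => ?_⟩
      have hb' := hb β
      simp only [Holds] at hb' ⊢
      rw [Finset.forall_mem_insert, ← hb']
      cases h : α t <;> simp [eval]
  obtain ⟨b, hb⟩ := key Finset.univ
  exact ⟨b, fun β => by rw [hb β]; simp [funext_iff]⟩

theorem exists_denotes [Finite T] (S : Set (At T)) :
    ∃ b : BExp T, ∀ α : At T, b.Holds α ↔ α ∈ S := by
  classical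
  induction S, S.toFinite using Set.Finite.induction_on with
  | empty => exact ⟨zero, fun β => by simp [Holds, eval]⟩
  | @insert α S _ _ ih =>
    obtain ⟨b, hb⟩ := ih
    obtain ⟨c, hc⟩ := exists_denotes_atom α
    refine ⟨or c b, fun β => ?_⟩
    rw [Set.mem_insert_iff, ← hc β, ← hb β]
    simp [Holds, eval]

end BExp

/-! ### Expressions -/

/-- ProbGKAT expressions over primitive tests `T`, actions `Act` and return values `Out`. -/
inductive Exp (T : Type u) (Act : Type v) (Out : Type w) : Type (max u v w)
  /-- `do p` -/
  | act (p : Act) : Exp T Act Out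
  /-- `assert b` -/
  | test (b : BExp T) : Exp T Act Out
  /-- `e +_b f`, if `b` then `e` else `f` -/
  | gchoice (b : BExp T) (e f : Exp T Act Out) : Exp T Act Out
  /-- `e ; f` -/
  | seq (e f : Exp T Act Out) : Exp T Act Out
  /-- `e^(b)`, while `b` do `e` -/
  | gloop (b : BExp T) (e : Exp T Act Out) : Exp T Act Out
  /-- `return v` -/
  | ret (v : Out) : Exp T Act Out
  /-- `e ⊕_r f`, if flip(`r`) then `e` else `f` -/
  | pchoice (r : I) (e f : Exp T Act Out) : Exp T Act Out
  /-- `e^[r]`, while flip(`r`) do `e` -/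
  | ploop (r : I) (e : Exp T Act Out) : Exp T Act Out

/-! ### Automata and bisimulations -/

/-- The set `2 + Out` of terminating outcomes. -/
inductive Halt (Out : Type w) : Type w
  | reject : Halt Out
  | accept : Halt Out
  | ret (v : Out) : Halt Out

/-- The set `2 + Out + Act × X` of outcomes of a step. -/
abbrev Outcome (Act : Type v) (Out : Type w) (X : Type x) : Type (max v w x) :=
  Halt Out ⊕ (Act × X)

/-- Finitely supported probability distributions on `X`. -/
abbrev FinDist (X : Type x) : Type x := StdSimplex ℝ X

open Classical in
/-- The probability `ν[A]` of a set `A`. -/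
def FinDist.mass {X : Type x} (ν : FinDist X) (A : Set X) : ℝ :=
  ∑ a ∈ ν.weights.support with a ∈ A, ν.weights a

/-- A ProbGKAT automaton with state set `X`, given by its transition function. -/
abbrev Automaton (T : Type u) (Act : Type v) (Out : Type w) (X : Type x) :
    Type (max u v w x) :=
  X → At T → FinDist (Outcome Act Out X)

variable {T : Type u} {Act : Type v} {Out : Type w}

/-- Homomorphisms of ProbGKAT automata. -/
structure IsHom {X : Type x} {Y : Type y} (β : Automaton T Act Out X)
    (γ : Automaton T Act Out Y) (f : X → Y) : Prop where
  halt : ∀ (s : X) (α : At T) (o : Halt Out),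
    (γ (f s) α).weights (Sum.inl o) = (β s α).weights (Sum.inl o)
  step : ∀ (s : X) (α : At T) (p : Act) (t : Y),
    (γ (f s) α).weights (Sum.inr (p, t)) =
      FinDist.mass (β s α) {d | ∃ s' : X, f s' = t ∧ d = Sum.inr (p, s')}

/-- `R` is a bisimulation if it carries a transition function for which both projections are
homomorphisms. -/
def IsBisimulation {X : Type x} {Y : Type y} (β : Automaton T Act Out X)
    (γ : Automaton T Act Out Y) (R : X → Y → Prop) : Prop :=
  ∃ ρ : Automaton T Act Out {q : X × Y // R q.1 q.2},
    IsHom ρ β (fun q => q.1.1) ∧ IsHom ρ γ (fun q => q.1.2)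

/-- Bisimilarity: being related by some bisimulation. -/
def Bisimilar {X : Type x} {Y : Type y} (β : Automaton T Act Out X)
    (γ : Automaton T Act Out Y) (s : X) (t : Y) : Prop :=
  ∃ R : X → Y → Prop, IsBisimulation β γ R ∧ R s t

/-! ### The Brzozowski automaton -/

/-- Outcome distributions of expressions. -/
abbrev Behaviour (T : Type u) (Act : Type v) (Out : Type w) : Type (max u v w) :=
  FinDist (Outcome Act Out (Exp T Act Out))

/-- The convex combination `r ν + (1 - r) μ`. -/
def mix {X : Type x} (r : I) (ν μ : FinDist X) : FinDist X :=
  convexCombPair (r : ℝ) (1 - r) r.2.1 (sub_nonneg.2 r.2.2) (add_sub_cancel _ _) ν μ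

/-- The map `c_{α,f}`, where `ν` stands for `∂(f)_α`. -/
def seqOutcome (f : Exp T Act Out) (ν : Behaviour T Act Out) :
    Outcome Act Out (Exp T Act Out) → Behaviour T Act Out
  | Sum.inl Halt.accept => ν
  | Sum.inl Halt.reject => StdSimplex.single (Sum.inl Halt.reject)
  | Sum.inl (Halt.ret v) => StdSimplex.single (Sum.inl (Halt.ret v))
  | Sum.inr (p, e') => StdSimplex.single (Sum.inr (p, Exp.seq e' f))

/-- Appends `l` to the target of a step, leaving terminating outcomes unchanged. -/
def appendTo (l : Exp T Act Out) :
    Outcome Act Out (Exp T Act Out) → Outcome Act Out (Exp T Act Out)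
  | Sum.inl o => Sum.inl o
  | Sum.inr (p, e') => Sum.inr (p, Exp.seq e' l)

/-- The unnormalised outcomes of a loop that exits with probability `1 - r` and otherwise runs a
body with outcomes `ν` that did not accept immediately, continuing with `l`. -/
def loopWeights (r : I) (ν : Behaviour T Act Out) (l : Exp T Act Out) :
    Outcome Act Out (Exp T Act Out) →₀ ℝ :=
  Finsupp.single (Sum.inl Halt.accept) (1 - (r : ℝ)) +
    (r : ℝ) • (ν.weights.erase (Sum.inl Halt.accept)).mapDomain (appendTo l)

theorem loopWeights_nonneg (r : I) (ν : Behaviour T Act Out) (l : Exp T Act Out) :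
    0 ≤ loopWeights r ν l := by
  classical
  refine add_nonneg (Finsupp.single_nonneg.2 (sub_nonneg.2 r.2.2))
    (smul_nonneg r.2.1 (Finsupp.mapDomain_nonneg ?_))
  intro d
  rw [Finsupp.erase_apply]
  split
  · exact le_rfl
  · exact ν.nonneg d

theorem loopWeights_total (r : I) (ν : Behaviour T Act Out) (l : Exp T Act Out) :
    (loopWeights r ν l).sum (fun _ a => a) =
      1 - (r : ℝ) * ν.weights (Sum.inl Halt.accept) := by
  classical
  have h := ν.total
  rw [← Finsupp.single_add_erase (Sum.inl Halt.accept) ν.weights,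
    Finsupp.sum_add_index' (by simp) (by simp)] at h
  simp only [Finsupp.sum_single_index] at h
  unfold loopWeights
  rw [Finsupp.sum_add_index' (by simp) (by simp), Finsupp.sum_smul_index (by simp),
    ← Finsupp.mul_sum, Finsupp.sum_mapDomain_index (by simp) (by simp),
    Finsupp.sum_single_index rfl]
  linear_combination (r : ℝ) * h

open Classical in
/-- Outcomes of a loop whose body has outcomes `ν`, which is (re-)entered with probability `r`, and
which continues as `l` after each step of the body. Diverging loops reject; otherwise the
probability of immediate acceptance of the body is redistributed. The pointwise values are
`loopDist_accept`, `loopDist_reject`, `loopDist_ret`, `loopDist_step` and `loopDist_other`. -/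
def loopDist (r : I) (ν : Behaviour T Act Out) (l : Exp T Act Out) : Behaviour T Act Out :=
  if h : 1 - (r : ℝ) * ν.weights (Sum.inl Halt.accept) = 0 then
    StdSimplex.single (Sum.inl Halt.reject)
  else
    { weights := (1 - (r : ℝ) * ν.weights (Sum.inl Halt.accept))⁻¹ • loopWeights r ν l
      nonneg := by
        refine smul_nonneg (inv_nonneg.2 ?_) (loopWeights_nonneg r ν l)
        rw [← loopWeights_total r ν l]
        exact Finsupp.sum_nonneg fun d _ => loopWeights_nonneg r ν l d
      total := by
        rw [Finsupp.sum_smul_index (by simp), ← Finsupp.mul_sum, loopWeights_total,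
          inv_mul_cancel₀ h] }

/-- The Brzozowski derivative. A guarded loop whose guard holds is re-entered with
probability `1`. -/
def derivative (α : At T) : Exp T Act Out → Behaviour T Act Out
  | .act p => StdSimplex.single (Sum.inr (p, Exp.test BExp.one))
  | .test b => StdSimplex.single (Sum.inl (if b.Holds α then Halt.accept else Halt.reject))
  | .gchoice b e f => if b.Holds α then derivative α e else derivative α f
  | .seq e f => (derivative α e).iConvexComb (seqOutcome f (derivative α f))
  | .gloop b e =>
      if b.Holds α then loopDist 1 (derivative α e) (Exp.gloop b e)
      else StdSimplex.single (Sum.inl Halt.accept)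
  | .ret v => StdSimplex.single (Sum.inl (Halt.ret v))
  | .pchoice r e f => mix r (derivative α e) (derivative α f)
  | .ploop r e => loopDist r (derivative α e) (Exp.ploop r e)

/-- The Brzozowski automaton `(Exp, ∂)`. -/
def brzozowski : Automaton T Act Out (Exp T Act Out) := fun e α => derivative α e

section Pointwise

variable {r : I} {ν : Behaviour T Act Out} {l : Exp T Act Out}

theorem appendTo_injective (l : Exp T Act Out) : Function.Injective (appendTo l) := by
  rintro (o | ⟨p, e⟩) (o' | ⟨p', e'⟩) h <;> simp_all [appendTo]

theorem loopDist_diverge (h : 1 - (r : ℝ) * ν.weights (Sum.inl Halt.accept) = 0) :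
    loopDist r ν l = StdSimplex.single (Sum.inl Halt.reject) := by
  simp [loopDist, h]

theorem loopDist_appendTo (h : 1 - (r : ℝ) * ν.weights (Sum.inl Halt.accept) ≠ 0)
    (d : Outcome Act Out (Exp T Act Out)) (hd : d ≠ Sum.inl Halt.accept) :
    (loopDist r ν l).weights (appendTo l d) =
      r * ν.weights d / (1 - r * ν.weights (Sum.inl Halt.accept)) := by
  classical
  have hd' : (Sum.inl Halt.accept : Outcome Act Out (Exp T Act Out)) ≠ appendTo l d := by
    intro hh
    exact hd (appendTo_injective l (show appendTo l d = appendTo l (Sum.inl Halt.accept) by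
      rw [← hh]; rfl))
  simp [loopDist, h, loopWeights, Finsupp.mapDomain_apply (appendTo_injective l),
    hd', hd]
  ring

theorem loopDist_accept (h : 1 - (r : ℝ) * ν.weights (Sum.inl Halt.accept) ≠ 0) :
    (loopDist r ν l).weights (Sum.inl Halt.accept) =
      (1 - r) / (1 - r * ν.weights (Sum.inl Halt.accept)) := by
  classical
  have := Finsupp.mapDomain_apply (appendTo_injective l)
    (ν.weights.erase (Sum.inl Halt.accept)) (Sum.inl Halt.accept)
  rw [show appendTo l (Sum.inl Halt.accept) = Sum.inl Halt.accept from rfl] at this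
  simp [loopDist, h, loopWeights, this]
  ring

theorem loopDist_reject (h : 1 - (r : ℝ) * ν.weights (Sum.inl Halt.accept) ≠ 0) :
    (loopDist r ν l).weights (Sum.inl Halt.reject) =
      r * ν.weights (Sum.inl Halt.reject) / (1 - r * ν.weights (Sum.inl Halt.accept)) :=
  loopDist_appendTo (l := l) h (Sum.inl Halt.reject) (by simp)

theorem loopDist_ret (h : 1 - (r : ℝ) * ν.weights (Sum.inl Halt.accept) ≠ 0) (v : Out) :
    (loopDist r ν l).weights (Sum.inl (Halt.ret v)) =
      r * ν.weights (Sum.inl (Halt.ret v)) / (1 - r * ν.weights (Sum.inl Halt.accept)) :=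
  loopDist_appendTo (l := l) h (Sum.inl (Halt.ret v)) (by simp)

theorem loopDist_step (h : 1 - (r : ℝ) * ν.weights (Sum.inl Halt.accept) ≠ 0) (p : Act)
    (e' : Exp T Act Out) :
    (loopDist r ν l).weights (Sum.inr (p, Exp.seq e' l)) =
      r * ν.weights (Sum.inr (p, e')) / (1 - r * ν.weights (Sum.inl Halt.accept)) :=
  loopDist_appendTo (l := l) h (Sum.inr (p, e')) (by simp)

theorem loopDist_other (p : Act) (g : Exp T Act Out) (hg : ∀ e', g ≠ Exp.seq e' l) :
    (loopDist r ν l).weights (Sum.inr (p, g)) = 0 := by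
  classical
  by_cases h : 1 - (r : ℝ) * ν.weights (Sum.inl Halt.accept) = 0
  · simp [loopDist, h]
  · have : ((ν.weights.erase (Sum.inl Halt.accept)).mapDomain (appendTo l)) (Sum.inr (p, g)) = 0 := by
      apply Finsupp.mapDomain_of_notMem_range
      rintro ⟨(o | ⟨q, e'⟩), hh⟩ <;> simp [appendTo] at hh
      exact hg e' hh.2.symm
    simp [loopDist, h, loopWeights, this]

end Pointwise

/-! ### The axiomatisation -/

/-- The immediate termination probability `E(e)_α`. -/
def termProb (α : At T) : Exp T Act Out → ℝ
  | .act _ => 0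
  | .ret _ => 0
  | .test b => if b.Holds α then 1 else 0
  | .gchoice b e f => if b.Holds α then termProb α e else termProb α f
  | .pchoice r e f => r * termProb α e + (1 - r) * termProb α f
  | .seq e f => termProb α e * termProb α f
  | .gloop b _ => if b.not.Holds α then 1 else 0
  | .ploop r e =>
      open Classical in
      if (r : ℝ) = 1 ∧ termProb α e = 1 then 0 else (1 - r) / (1 - r * termProb α e)

/-- The side condition `E(e) = 0`. -/
def NoTerm (e : Exp T Act Out) : Prop := ∀ α : At T, termProb α e = 0

open Exp in
/-- Provable equivalence `≡`: the least congruence satisfying the axioms. Tests, also where they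
occur as guards, are taken up to Boolean equivalence. -/
inductive ProvEquiv : Exp T Act Out → Exp T Act Out → Prop
  -- equivalence relation
  | refl (e) : ProvEquiv e e
  | symm {e f} : ProvEquiv e f → ProvEquiv f e
  | trans {e f g} : ProvEquiv e f → ProvEquiv f g → ProvEquiv e g
  -- compatibility with the operations
  | test_congr {b c} : b.BAEquiv c → ProvEquiv (test b) (test c)
  | gchoice_congr {b c e e' f f'} : b.BAEquiv c → ProvEquiv e e' → ProvEquiv f f' →
      ProvEquiv (gchoice b e f) (gchoice c e' f')
  | seq_congr {e e' f f'} : ProvEquiv e e' → ProvEquiv f f' → ProvEquiv (seq e f) (seq e' f')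
  | gloop_congr {b c e e'} : b.BAEquiv c → ProvEquiv e e' → ProvEquiv (gloop b e) (gloop c e')
  | pchoice_congr {e e' f f'} (r) : ProvEquiv e e' → ProvEquiv f f' →
      ProvEquiv (pchoice r e f) (pchoice r e' f')
  | ploop_congr {e e'} (r) : ProvEquiv e e' → ProvEquiv (ploop r e) (ploop r e')
  -- guarded choice
  | G1 (b e) : ProvEquiv (gchoice b e e) e
  | G2 (b e f) : ProvEquiv (gchoice b e f) (gchoice b (seq (test b) e) f)
  | G3 (b e f) : ProvEquiv (gchoice b e f) (gchoice b.not f e)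
  | G4 (b c e f g) :
      ProvEquiv (gchoice c (gchoice b e f) g) (gchoice (b.and c) e (gchoice c f g))
  -- distributivity
  | D (r b e f g) :
      ProvEquiv (pchoice r e (gchoice b f g)) (gchoice b (pchoice r e f) (pchoice r e g))
  -- sequencing
  | S1 (e) : ProvEquiv (seq (test BExp.one) e) e
  | S2 (e) : ProvEquiv (seq e (test BExp.one)) e
  | S3 (e f g) : ProvEquiv (seq (seq e f) g) (seq e (seq f g))
  | S4 (e) : ProvEquiv (seq (test BExp.zero) e) (test BExp.zero)
  | S5 (b e f g) : ProvEquiv (seq (gchoice b e f) g) (gchoice b (seq e g) (seq f g))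
  | S6 (r e f g) : ProvEquiv (seq (pchoice r e f) g) (pchoice r (seq e g) (seq f g))
  | S7 (v e) : ProvEquiv (seq (ret v) e) (ret v)
  | S8 (b c) : ProvEquiv (seq (test b) (test c)) (test (b.and c))
  -- loops
  | L1 (b e) : ProvEquiv (gloop b e) (gchoice b (seq e (gloop b e)) (test BExp.one))
  | L2 (r e) : ProvEquiv (ploop r e) (pchoice r (seq e (ploop r e)) (test BExp.one))
  | L3 (b c e) :
      ProvEquiv (gloop b (gchoice c e (test BExp.one))) (gloop b (seq (test c) e))
  | L4 (e) : ProvEquiv (gloop BExp.one e) (ploop 1 e)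
  | L5 {s : I} {b c e f g} :
      ProvEquiv e (gchoice c (pchoice s f (test BExp.one)) g) → (0 : ℝ) < s →
      ProvEquiv (seq (test c) (gloop b e))
        (seq (test c) (gchoice b (seq f (gloop b e)) (test BExp.one)))
  | L6 {r s : I} {c e f g} (q : I) :
      ProvEquiv e (gchoice c (pchoice s f (test BExp.one)) g) →
      (1 : ℝ) - r * (1 - s) ≠ 0 → (q : ℝ) = r * s / (1 - r * (1 - s)) →
      ProvEquiv (seq (test c) (ploop r e))
        (seq (test c) (pchoice q (seq f (ploop r e)) (test BExp.one)))
  -- probabilistic choice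
  | P1 (r e) : ProvEquiv (pchoice r e e) e
  | P2 (e f) : ProvEquiv (pchoice 1 e f) e
  | P3 (r e f) : ProvEquiv (pchoice r e f) (pchoice (σ r) f e)
  | P4 (r s q : I) (e f g) :
      (1 : ℝ) - r * s ≠ 0 → (q : ℝ) = (1 - r) * s / (1 - r * s) →
      ProvEquiv (pchoice s (pchoice r e f) g) (pchoice (r * s) e (pchoice q f g))
  -- fixpoint rules
  | F1 {b e f g} : ProvEquiv g (gchoice b (seq e g) f) → NoTerm e →
      ProvEquiv g (seq (gloop b e) f)
  | F2 {r e f g} : ProvEquiv g (pchoice r (seq e g) f) → NoTerm e →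
      ProvEquiv g (seq (ploop r e) f)

/-! ### Systems of equations and the uniqueness axiom -/

/-- The sort `PExp(X)` of right-hand sides over the indeterminates `X`. -/
inductive PSys (T : Type u) (Act : Type v) (Out : Type w) (X : Type x) : Type (max u v w x)
  /-- `f` -/
  | const (f : Exp T Act Out) : PSys T Act Out X
  /-- `g x` -/
  | var (g : Exp T Act Out) (i : X) : PSys T Act Out X
  /-- `p₁ ⊕_r p₂` -/
  | pchoice (r : I) (p₁ p₂ : PSys T Act Out X) : PSys T Act Out X

/-- The sort `Exp(X)` of right-hand sides over the indeterminates `X`. -/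
inductive Sys (T : Type u) (Act : Type v) (Out : Type w) (X : Type x) : Type (max u v w x)
  /-- `p` -/
  | prob (p : PSys T Act Out X) : Sys T Act Out X
  /-- `e₁ +_b e₂` -/
  | gchoice (b : BExp T) (e₁ e₂ : Sys T Act Out X) : Sys T Act Out X

variable {X : Type x}

/-- All subterms `g x` satisfy `E(g) = 0`. -/
def PSys.Guarded : PSys T Act Out X → Prop
  | .const _ => True
  | .var g _ => NoTerm g
  | .pchoice _ p₁ p₂ => p₁.Guarded ∧ p₂.Guarded

/-- All subterms `g x` satisfy `E(g) = 0`. -/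
def Sys.Guarded : Sys T Act Out X → Prop
  | .prob p => p.Guarded
  | .gchoice _ e₁ e₂ => e₁.Guarded ∧ e₂.Guarded

/-- The extension `h^#` of an assignment `h` of expressions to indeterminates. -/
def PSys.subst (h : X → Exp T Act Out) : PSys T Act Out X → Exp T Act Out
  | .const f => f
  | .var g i => Exp.seq g (h i)
  | .pchoice r p₁ p₂ => Exp.pchoice r (p₁.subst h) (p₂.subst h)

/-- The extension `h^#` of an assignment `h` of expressions to indeterminates. -/
def Sys.subst (h : X → Exp T Act Out) : Sys T Act Out X → Exp T Act Out
  | .prob p => p.subst h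
  | .gchoice b e₁ e₂ => Exp.gchoice b (e₁.subst h) (e₂.subst h)

/-- The system of equations `(X, τ)` is Salomaa. -/
def IsSalomaa (τ : X → Sys T Act Out X) : Prop := ∀ i, (τ i).Guarded

/-- `h` is a solution up to `R` of the system `(X, τ)`. -/
def IsSolution (R : Exp T Act Out → Exp T Act Out → Prop) (τ : X → Sys T Act Out X)
    (h : X → Exp T Act Out) : Prop :=
  ∀ i, R (h i) ((τ i).subst h)

open Exp in
/-- The relation `≡̇`: the least congruence that contains `≡` and satisfies the uniqueness axiom
(any two solutions of a finite Salomaa system are equivalent). -/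
inductive UAEquiv : Exp T Act Out → Exp T Act Out → Prop
  | of_equiv {e f} : ProvEquiv e f → UAEquiv e f
  -- equivalence relation
  | refl (e) : UAEquiv e e
  | symm {e f} : UAEquiv e f → UAEquiv f e
  | trans {e f g} : UAEquiv e f → UAEquiv f g → UAEquiv e g
  -- compatibility with the operations
  | gchoice_congr {e e' f f'} (b) : UAEquiv e e' → UAEquiv f f' →
      UAEquiv (gchoice b e f) (gchoice b e' f')
  | seq_congr {e e' f f'} : UAEquiv e e' → UAEquiv f f' → UAEquiv (seq e f) (seq e' f')
  | gloop_congr {e e'} (b) : UAEquiv e e' → UAEquiv (gloop b e) (gloop b e')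
  | pchoice_congr {e e' f f'} (r) : UAEquiv e e' → UAEquiv f f' →
      UAEquiv (pchoice r e f) (pchoice r e' f')
  | ploop_congr {e e'} (r) : UAEquiv e e' → UAEquiv (ploop r e) (ploop r e')
  -- uniqueness of solutions
  | ua {X : Type} [Finite X] (τ : X → Sys T Act Out X) (f g : X → Exp T Act Out) :
      IsSalomaa τ → IsSolution UAEquiv τ f → IsSolution UAEquiv τ g →
      ∀ i, UAEquiv (f i) (g i)

end ProbGKAT

end

noncomputable section

namespace ProbGKAT

open Convexity
open scoped unitInterval NNReal

universe u v w x y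

/-! ### Barycentric algebras and their cones -/

/-! A bisimulation carries an automaton structure of its own, and both of its projections are
homomorphisms into the Brzozowski automaton. If finitely many pairs are reachable, their transitions
form a finite Salomaa system with one indeterminate per pair. Both projections solve this same
system, so the uniqueness axiom identifies them at the pair `(e, f)`. Finiteness holds because every
expression has finitely many iterated derivatives (`exists_finite_derivClosed`).

That the projections are solutions is the fundamental theorem: every expression is provably the
probabilistic sum of its outcomes (`val_eq_outcomeSum_derivative`). It is proved one atom at a time.
Provable equivalence under an atom test (`AtEquiv`) still admits convex combinations, and agreement
at all of the finitely many atoms gives provable equivalence (`ProvEquiv.of_atEquiv`). The quotient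
by `AtEquiv` is a barycentric algebra. It embeds into a module over the non-negative reals, its
cone, where nested binary choices become finite weighted sums and reassociation becomes linear
algebra.

The induction is then linear except at loops. There the body is written at the atom as `f ⊕_s 1`,
and L5 or L6 removes the immediate acceptance and renormalises. Diverging loops are handled by L3
and L4. -/

/-- Sets with binary convex combinations. -/
class BarycentricAlgebra (A : Type u) where
  comb : I → A → A → A
  comb_self (r a) : comb r a a = a
  comb_one (a b) : comb 1 a b = a
  comb_comm (r a b) : comb r a b = comb (σ r) b a
  comb_assoc (r s q : I) (a b c) : (1 : ℝ) - r * s ≠ 0 → (q : ℝ) = (1 - r) * s / (1 - r * s) →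
    comb s (comb r a b) c = comb (r * s) a (comb q b c)

/-- The cone over a barycentric algebra: formal positive multiples of its points, and zero. -/
inductive Cone (A : Type u) : Type u
  | zero : Cone A
  | ray (r : ℝ) (hr : 0 < r) (a : A) : Cone A

/-- The proportion of `s` in `s + t`. -/
def ratio (s t : ℝ) (hs : 0 < s) (ht : 0 < t) : I :=
  ⟨s / (s + t), by positivity, by rw [div_le_one (by positivity)]; linarith⟩

namespace Cone

open BarycentricAlgebra

variable {A : Type u} {B : Type v}

theorem ray_congr {r s : ℝ} {hr : 0 < r} {hs : 0 < s} {a b : A} (h : r = s) (hab : a = b) :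
    ray r hr a = ray s hs b := by
  subst h hab; rfl

instance : Zero (Cone A) := ⟨zero⟩

theorem zero_def : (zero : Cone A) = 0 := rfl

open Classical in
instance : SMul ℝ≥0 (Cone A) where
  smul c
    | zero => zero
    | ray r hr a => if h : 0 < c then ray (c * r) (mul_pos h hr) a else zero

theorem smul_ray {c : ℝ≥0} (hc : 0 < c) {r : ℝ} (hr : 0 < r) (a : A) :
    c • ray r hr a = ray (c * r) (mul_pos hc hr) a := dif_pos hc

theorem zero_smul_ray {r : ℝ} (hr : 0 < r) (a : A) : (0 : ℝ≥0) • ray r hr a = 0 :=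
  dif_neg (lt_irrefl _)

/-- The inclusion of a barycentric algebra into its cone. -/
def unit (a : A) : Cone A := ray 1 one_pos a

/-- Points are the rays of length one, stored as data with no quotient taken. Hence identities
computed in the module descend to the algebra, although addition in the cone need not be
cancellative. -/
theorem unit_injective : Function.Injective (unit : A → Cone A) := by
  intro a b h
  injection h
variable [BarycentricAlgebra A] [BarycentricAlgebra B]

/-- Addition in the cone. -/
protected def add : Cone A → Cone A → Cone A
  | zero, y => y
  | x, zero => x
  | ray s hs a, ray t ht b => ray (s + t) (add_pos hs ht) (comb (ratio s t hs ht) a b)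

instance : Add (Cone A) := ⟨Cone.add⟩

theorem ray_add_ray {s t : ℝ} (hs : 0 < s) (ht : 0 < t) (a b : A) :
    ray s hs a + ray t ht b =
      ray (s + t) (add_pos hs ht) (comb (ratio s t hs ht) a b) := rfl

instance : AddCommMonoid (Cone A) where
  zero_add x := by cases x <;> rfl
  add_zero x := by cases x <;> rfl
  add_comm x y := by
    cases x <;> cases y <;> try rfl
    rename_i s hs a t ht b
    rw [ray_add_ray, ray_add_ray]
    refine ray_congr (add_comm _ _) ?_
    rw [comb_comm]
    congr 1
    ext
    simp only [ratio, unitInterval.coe_symm_eq]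
    field_simp
    ring
  add_assoc x y z := by
    cases x <;> cases y <;> cases z <;> try rfl
    rename_i s hs a t ht b u hu c
    simp only [ray_add_ray]
    refine ray_congr (add_assoc _ _ _) ?_
    have h1 : (ratio s t hs ht : ℝ) * ratio (s + t) u (add_pos hs ht) hu = s / (s + t + u) := by
      simp only [ratio]; field_simp
    have h2 : (1 : ℝ) - s / (s + t + u) = (t + u) / (s + t + u) := by field_simp; ring
    -- Reassociation leaves the second point with its share `t / (t + u)` of the remaining mass.
    rw [comb_assoc _ _ (ratio t u ht hu)]
    · congr 1
      ext
      rw [Set.Icc.coe_mul, h1]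
      simp only [ratio, add_assoc]
    · rw [h1, h2]; positivity
    · rw [h1, h2]
      simp only [ratio]
      field_simp
      ring
  nsmul := nsmulRec

instance : Module ℝ≥0 (Cone A) where
  one_smul x := by
    cases x
    · rfl
    · rw [smul_ray one_pos]; exact ray_congr (by simp) rfl
  mul_smul c d x := by
    cases x
    · rfl
    · rcases (zero_le (a := c)).eq_or_lt with rfl | hc
      · rcases (zero_le (a := d)).eq_or_lt with rfl | hd
        · rw [mul_zero, zero_smul_ray]; rfl
        · rw [zero_mul, zero_smul_ray, smul_ray hd, zero_smul_ray]
      · rcases (zero_le (a := d)).eq_or_lt with rfl | hd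
        · rw [mul_zero, zero_smul_ray]; rfl
        · rw [smul_ray hd, smul_ray hc, smul_ray (mul_pos hc hd)]
          exact ray_congr (by push_cast; ring) rfl
  smul_zero c := rfl
  zero_smul x := by
    cases x
    · rfl
    · exact zero_smul_ray _ _
  smul_add c x y := by
    rcases x with _ | ⟨s, hs, a⟩
    · rw [zero_def, zero_add]; exact (zero_add _).symm
    rcases y with _ | ⟨t, ht, b⟩
    · rw [zero_def, add_zero]; exact (add_zero _).symm
    rcases (zero_le (a := c)).eq_or_lt with rfl | hc
    · rw [ray_add_ray]; simp only [zero_smul_ray, add_zero]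
    · rw [ray_add_ray, smul_ray hc, smul_ray hc, smul_ray hc, ray_add_ray]
      refine ray_congr (mul_add _ _ _) ?_
      congr 1
      ext
      have : (0 : ℝ) < c := hc
      simp only [ratio]
      field_simp
  add_smul c d x := by
    rcases x with _ | ⟨s, hs, a⟩
    · exact (zero_add _).symm
    rcases (zero_le (a := c)).eq_or_lt with rfl | hc
    · rw [zero_add, zero_smul_ray, zero_add]
    rcases (zero_le (a := d)).eq_or_lt with rfl | hd
    · rw [add_zero, zero_smul_ray, add_zero]
    rw [smul_ray hc, smul_ray hd, smul_ray (add_pos hc hd), ray_add_ray, comb_self]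
    exact ray_congr (by push_cast; ring) rfl

theorem comb_zero (a b : A) : comb 0 a b = b := by
  rw [comb_comm, unitInterval.symm_zero, comb_one]

/-- The endpoints are separate cases because a ray must have positive length. -/
theorem unit_comb (r : I) (a b : A) :
    unit (comb r a b) = unitInterval.toNNReal r • unit a + unitInterval.toNNReal (σ r) • unit b := by
  rcases (unitInterval.nonneg' (t := r)).eq_or_lt with rfl | h0
  · simp [comb_zero]
  rcases (unitInterval.le_one' (t := r)).eq_or_lt with rfl | h1
  · simp [comb_one]
  have h0' : 0 < unitInterval.toNNReal r := h0
  have h1' : 0 < unitInterval.toNNReal (σ r) := by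
    have : (r : ℝ) < 1 := h1
    rw [← NNReal.coe_pos]
    simpa using this
  unfold unit
  rw [smul_ray h0', smul_ray h1', ray_add_ray]
  refine ray_congr (by simp) ?_
  congr 1
  ext
  simp [ratio]

/-- The linear map induced by an affine map. -/
def map (f : A → B) (hf : ∀ r a b, f (comb r a b) = comb r (f a) (f b)) :
    Cone A →ₗ[ℝ≥0] Cone B where
  toFun
    | zero => zero
    | ray r hr a => ray r hr (f a)
  map_add' x y := by
    rcases x with _ | ⟨s, hs, a⟩
    · rw [zero_def, zero_add]; exact (zero_add _).symm
    rcases y with _ | ⟨t, ht, b⟩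
    · rw [zero_def, add_zero]; exact (add_zero _).symm
    exact ray_congr rfl (hf _ _ _)
  map_smul' c x := by
    rcases x with _ | ⟨s, hs, a⟩
    · rfl
    rcases (zero_le (a := c)).eq_or_lt with rfl | hc
    · simp only [zero_smul_ray]; exact (zero_smul_ray _ _).symm
    · rw [smul_ray hc]; exact (smul_ray hc _ _).symm

end Cone

/-! ### Sums with non-negative real weights -/

section WeightedSum

variable {Y : Type x} {Z : Type y} {M : Type u} {N : Type v}
  [AddCommMonoid M] [Module ℝ≥0 M] [AddCommMonoid N] [Module ℝ≥0 N]

/-- The sum of the `φ y` with weights `w y`. -/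
def weightedSum (w : Y →₀ ℝ) (φ : Y → M) : M := w.sum fun y a => a.toNNReal • φ y

theorem weightedSum_single (y : Y) (a : ℝ) (φ : Y → M) :
    weightedSum (Finsupp.single y a) φ = a.toNNReal • φ y :=
  Finsupp.sum_single_index (by simp)

theorem weightedSum_zero (φ : Y → M) : weightedSum 0 φ = 0 := Finsupp.sum_zero_index

theorem weightedSum_eq_sum_of_subset {w : Y →₀ ℝ} {s : Finset Y} (h : w.support ⊆ s) (φ : Y → M) :
    weightedSum w φ = ∑ y ∈ s, (w y).toNNReal • φ y :=
  Finsupp.sum_of_support_subset _ h _ (by simp)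

/-- Non-negativity matters: `Real.toNNReal` truncates negative weights to zero and is not additive
across signs. -/
theorem weightedSum_add {w w' : Y →₀ ℝ} (hw : 0 ≤ w) (hw' : 0 ≤ w') (φ : Y → M) :
    weightedSum (w + w') φ = weightedSum w φ + weightedSum w' φ := by
  classical
  rw [weightedSum_eq_sum_of_subset Finsupp.support_add,
    weightedSum_eq_sum_of_subset (Finset.subset_union_left : _ ⊆ w.support ∪ w'.support),
    weightedSum_eq_sum_of_subset (Finset.subset_union_right : _ ⊆ w.support ∪ w'.support),
    ← Finset.sum_add_distrib]
  refine Finset.sum_congr rfl fun y _ => ?_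
  rw [Finsupp.add_apply, Real.toNNReal_add (hw y) (hw' y), add_smul]

theorem weightedSum_smul {c : ℝ} (hc : 0 ≤ c) (w : Y →₀ ℝ) (φ : Y → M) :
    weightedSum (c • w) φ = c.toNNReal • weightedSum w φ := by
  unfold weightedSum
  rw [Finsupp.sum_smul_index (by simp), Finsupp.smul_sum]
  simp only [Real.toNNReal_mul hc, mul_smul]

theorem weightedSum_congr {w : Y →₀ ℝ} {φ ψ : Y → M} (h : ∀ y, w y ≠ 0 → φ y = ψ y) :
    weightedSum w φ = weightedSum w ψ :=
  Finsupp.sum_congr fun y hy => by rw [h y (Finsupp.mem_support_iff.1 hy)]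

theorem map_weightedSum (f : M →ₗ[ℝ≥0] N) (w : Y →₀ ℝ) (φ : Y → M) :
    f (weightedSum w φ) = weightedSum w fun y => f (φ y) := by
  unfold weightedSum
  rw [map_finsuppSum]
  simp only [map_smul]

theorem weightedSum_sum {ι : Type*} (s : Finset ι) {w : ι → Y →₀ ℝ} (hw : ∀ i, 0 ≤ w i)
    (φ : Y → M) : weightedSum (∑ i ∈ s, w i) φ = ∑ i ∈ s, weightedSum (w i) φ := by
  classical
  induction s using Finset.induction_on with
  | empty => exact weightedSum_zero φ
  | insert i s hi ih =>
    rw [Finset.sum_insert hi, Finset.sum_insert hi, ← ih,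
      weightedSum_add (hw i) (Finset.sum_nonneg fun i _ => hw i)]

theorem weightedSum_mapDomain {w : Y →₀ ℝ} (hw : 0 ≤ w) (f : Y → Z) (φ : Z → M) :
    weightedSum (w.mapDomain f) φ = weightedSum w (φ ∘ f) := by
  unfold Finsupp.mapDomain Finsupp.sum
  rw [weightedSum_sum _ fun y => Finsupp.single_nonneg.2 (hw y)]
  simp only [weightedSum_single]
  rfl

theorem weightedSum_erase_add {w : Y →₀ ℝ} (hw : 0 ≤ w) (y : Y) (φ : Y → M) :
    weightedSum w φ = (w y).toNNReal • φ y + weightedSum (w.erase y) φ := by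
  classical
  conv_lhs => rw [← Finsupp.single_add_erase y w]
  rw [weightedSum_add (Finsupp.single_nonneg.2 (hw y)), weightedSum_single]
  intro z
  rw [Finsupp.erase_apply]
  split
  · exact le_rfl
  · exact hw z

theorem FinDist.weights_iConvexComb (ν : FinDist Y) (μ : Y → FinDist Z) :
    (ν.iConvexComb μ).weights = ν.weights.sum fun y r => r • (μ y).weights := by
  simp [iConvexComb, Finsupp.sum_mapDomain_index, add_smul]

theorem weightedSum_iConvexComb (ν : FinDist Y) (μ : Y → FinDist Z) (φ : Z → M) :
    weightedSum (ν.iConvexComb μ).weights φ =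
      weightedSum ν.weights fun y => weightedSum (μ y).weights φ := by
  rw [FinDist.weights_iConvexComb]
  unfold Finsupp.sum
  rw [weightedSum_sum _ fun y => smul_nonneg (ν.nonneg y) (μ y).nonneg]
  simp only [weightedSum_smul (ν.nonneg _)]
  rfl

theorem weightedSum_mix (r : I) (ν μ : FinDist Y) (φ : Y → M) :
    weightedSum (mix r ν μ).weights φ = unitInterval.toNNReal r • weightedSum ν.weights φ +
      unitInterval.toNNReal (σ r) • weightedSum μ.weights φ := by
  have h : 0 ≤ 1 - (r : ℝ) := sub_nonneg.2 r.2.2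
  unfold mix
  rw [StdSimplex.weights_convexCombPair, weightedSum_add (smul_nonneg r.2.1 ν.nonneg)
    (smul_nonneg h μ.nonneg), weightedSum_smul r.2.1, weightedSum_smul h]
  congr 2
  · exact Real.toNNReal_of_nonneg _
  · exact Real.toNNReal_of_nonneg _

end WeightedSum

/-- Finitely supported distributions are generated by point masses and binary mixtures. -/
theorem FinDist.induction {Y : Type x} {P : FinDist Y → Prop}
    (single : ∀ y, P (StdSimplex.single y))
    (mix : ∀ r ν μ, P ν → P μ → P (mix r ν μ)) (ν : FinDist Y) : P ν := by
  classical
  induction hn : ν.weights.support.card using Nat.strong_induction_on generalizing ν with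
  | _ n ih =>
    obtain ⟨y, hy⟩ := ν.support_weights_nonempty
    by_cases hs : ν.weights.support = {y}
    · rw [StdSimplex.support_weights_eq_singleton.1 hs]; exact single y
    have h1 : ∃ a ∈ ({y} : Set Y), ν.weights a ≠ 0 := ⟨y, rfl, Finsupp.mem_support_iff.1 hy⟩
    have h2 : ∃ a ∈ ({y} : Set Y)ᶜ, ν.weights a ≠ 0 := by
      by_contra! h
      refine hs (Finset.eq_singleton_iff_unique_mem.2 ⟨hy, fun z hz => ?_⟩)
      by_contra hzy
      exact Finsupp.mem_support_iff.1 hz (h z hzy)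
    have key : ∀ (s t : ℝ) (hs : 0 ≤ s) (ht : 0 ≤ t) (hst : s + t = 1) (ν μ : FinDist Y),
        P ν → P μ → P (convexCombPair s t hs ht hst ν μ) := by
      intro s t hs ht hst ν μ hν hμ
      obtain rfl : t = 1 - s := by linarith
      exact mix ⟨s, hs, by linarith⟩ ν μ hν hμ
    -- Condition on `y` and on its complement: the first part is a point mass, and the second has
    -- lost `y` from its support.
    rw [← StdSimplex.convexCombPair_restrict_restrict_compl ν {y} h1 h2]
    refine key _ _ _ _ _ _ _ ?_ ?_
    · rw [StdSimplex.restrict_singleton]; exact single y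
    · refine ih _ ?_ _ rfl
      rw [← hn, StdSimplex.support_weights_restrict]
      refine Finset.card_lt_card (Finset.filter_ssubset.2 ⟨y, hy, by simp⟩)

variable {T : Type u} {Act : Type v} {Out : Type w}

/-! ### Consequences of the axioms for guards -/

namespace ProvEquiv

instance : Trans (ProvEquiv (T := T) (Act := Act) (Out := Out)) ProvEquiv ProvEquiv :=
  ⟨trans⟩

variable {b c : BExp T} {e e' f f' : Exp T Act Out}

theorem gchoice_args (b : BExp T) (he : ProvEquiv e e') (hf : ProvEquiv f f') :
    ProvEquiv (.gchoice b e f) (.gchoice b e' f') :=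
  gchoice_congr (fun _ => rfl) he hf

theorem test_seq_test_seq (b c : BExp T) (e : Exp T Act Out) :
    ProvEquiv (.seq (.test b) (.seq (.test c) e)) (.seq (.test (b.and c)) e) :=
  ((S3 _ _ _).symm).trans (seq_congr (S8 b c) (refl e))

theorem test_seq_disjoint (h : ∀ α, ¬ (b.Holds α ∧ c.Holds α)) (e : Exp T Act Out) :
    ProvEquiv (.seq (.test b) (.seq (.test c) e)) (.test .zero) := by
  refine (test_seq_test_seq b c e).trans ((seq_congr (test_congr fun α => ?_) (refl e)).trans (S4 e))
  have := h α
  simp only [BExp.Holds] at this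
  cases hb : b.eval α <;> cases hc : c.eval α <;> simp_all [BExp.eval]

/-- This is G2 for the second branch, with G3 swapping the branches before and after. -/
theorem gchoice_else (b : BExp T) (e f : Exp T Act Out) :
    ProvEquiv (.gchoice b e f) (.gchoice b e (.seq (.test b.not) f)) :=
  ((G3 b e f).trans (G2 b.not f e)).trans (G3 b e _).symm

theorem test_eq_gchoice (b : BExp T) :
    ProvEquiv (.test b : Exp T Act Out) (.gchoice b (.test .one) (.test .zero)) := by
  have h0 : ProvEquiv (.seq (.test b.not) (.test b) : Exp T Act Out) (.test .zero) :=
    (S8 _ _).trans (test_congr fun α => by simp [BExp.eval])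
  calc ProvEquiv (.test b : Exp T Act Out) (.gchoice b (.test b) (.test b)) := (G1 _ _).symm
    ProvEquiv _ (.gchoice b (.test b) (.seq (.test b.not) (.test b))) := gchoice_else _ _ _
    ProvEquiv _ (.gchoice b (.seq (.test b) (.test .one)) (.test .zero)) :=
      gchoice_args b (S2 _).symm h0
    ProvEquiv _ (.gchoice b (.test .one) (.test .zero)) := (G2 _ _ _).symm

/-- Expanding the test as a choice between `1` and `0` lets S5 distribute over it. A leading test
can thus be handled by the axioms for guarded choice. -/
theorem test_seq (b : BExp T) (e : Exp T Act Out) :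
    ProvEquiv (.seq (.test b) e) (.gchoice b e (.test .zero)) :=
  ((seq_congr (test_eq_gchoice b) (refl e)).trans (S5 _ _ _ _)).trans
    (gchoice_args b (S1 e) (S4 e))

/-- G4 pushes `f` into the else branch still guarded by `b`, where it is dead. -/
theorem test_seq_gchoice_self (b : BExp T) (e f : Exp T Act Out) :
    ProvEquiv (.seq (.test b) (.gchoice b e f)) (.seq (.test b) e) := by
  have h0 : ProvEquiv (.seq (.test b.not) (.gchoice b f (.test .zero))) (.test .zero) :=
    (seq_congr (refl _) (test_seq b f).symm).trans
      (test_seq_disjoint (fun α => by rw [BExp.holds_not]; tauto) f)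
  calc ProvEquiv (.seq (.test b) (.gchoice b e f)) (.gchoice b (.gchoice b e f) (.test .zero)) :=
        test_seq _ _
    ProvEquiv _ (.gchoice (b.and b) e (.gchoice b f (.test .zero))) := G4 _ _ _ _ _
    ProvEquiv _ (.gchoice b e (.gchoice b f (.test .zero))) :=
      gchoice_congr (fun α => by simp [BExp.eval]) (refl _) (refl _)
    ProvEquiv _ (.gchoice b e (.seq (.test b.not) (.gchoice b f (.test .zero)))) :=
      gchoice_else _ _ _
    ProvEquiv _ (.gchoice b e (.test .zero)) := gchoice_args b (refl _) h0
    ProvEquiv _ (.seq (.test b) e) := (test_seq _ _).symm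

theorem test_seq_absorb (h : ∀ α, b.Holds α → c.Holds α) (e : Exp T Act Out) :
    ProvEquiv (.seq (.test b) e) (.seq (.test b) (.seq (.test c) e)) := by
  refine (seq_congr (test_congr fun α => ?_) (refl e)).trans (test_seq_test_seq b c e).symm
  have := h α
  simp only [BExp.Holds] at this
  cases hb : b.eval α <;> simp_all [BExp.eval]

theorem test_seq_gchoice_of_le (h : ∀ α, b.Holds α → c.Holds α) (e f : Exp T Act Out) :
    ProvEquiv (.seq (.test b) (.gchoice c e f)) (.seq (.test b) e) :=
  ((test_seq_absorb h _).trans (seq_congr (refl _) (test_seq_gchoice_self c e f))).trans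
    (test_seq_absorb h e).symm

theorem test_seq_gchoice_of_le_not (h : ∀ α, b.Holds α → ¬ c.Holds α) (e f : Exp T Act Out) :
    ProvEquiv (.seq (.test b) (.gchoice c e f)) (.seq (.test b) f) :=
  (seq_congr (refl _) (G3 c e f)).trans
    (test_seq_gchoice_of_le (fun α hα => (BExp.holds_not c α).2 (h α hα)) f e)

/-- D distributes over the second argument of `⊕_r` and P3 carries it to the first; nested choices
on the same guard then collapse. This makes `⊕_r` compatible with equivalence at an atom. -/
theorem test_seq_pchoice (b : BExp T) (r : I) (e f : Exp T Act Out) :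
    ProvEquiv (.seq (.test b) (.pchoice r e f))
      (.pchoice r (.seq (.test b) e) (.seq (.test b) f)) := by
  have left : ∀ g : Exp T Act Out, ProvEquiv (.pchoice r (.gchoice b e (.test .zero)) g)
      (.gchoice b (.pchoice r e g) (.pchoice r (.test .zero) g)) := fun g =>
    calc ProvEquiv (.pchoice r (.gchoice b e (.test .zero)) g)
          (.pchoice (σ r) g (.gchoice b e (.test .zero))) := P3 _ _ _
      ProvEquiv _ (.gchoice b (.pchoice (σ r) g e) (.pchoice (σ r) g (.test .zero))) :=
        D _ _ _ _ _
      ProvEquiv _ (.gchoice b (.pchoice r e g) (.pchoice r (.test .zero) g)) :=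
        gchoice_args b (P3 _ _ _).symm (P3 _ _ _).symm
  have drop : ∀ g g' h h' : Exp T Act Out,
      ProvEquiv (.gchoice b (.gchoice b g g') (.gchoice b h h')) (.gchoice b g h') :=
    fun g g' h h' =>
    calc ProvEquiv (.gchoice b (.gchoice b g g') (.gchoice b h h'))
          (.gchoice b (.seq (.test b) (.gchoice b g g'))
            (.seq (.test b.not) (.gchoice b h h'))) := (G2 _ _ _).trans (gchoice_else _ _ _)
      ProvEquiv _ (.gchoice b (.seq (.test b) g) (.seq (.test b.not) h')) :=
        gchoice_args b (test_seq_gchoice_self _ _ _)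
          (test_seq_gchoice_of_le_not (fun α hα => (BExp.holds_not b α).1 hα) _ _)
      ProvEquiv _ (.gchoice b g h') := ((G2 _ _ _).trans (gchoice_else _ _ _)).symm
  apply ProvEquiv.symm
  calc ProvEquiv (.pchoice r (.seq (.test b) e) (.seq (.test b) f))
        (.pchoice r (.gchoice b e (.test .zero)) (.gchoice b f (.test .zero))) :=
        pchoice_congr r (test_seq _ _) (test_seq _ _)
    ProvEquiv _ (.gchoice b (.pchoice r (.gchoice b e (.test .zero)) f)
        (.pchoice r (.gchoice b e (.test .zero)) (.test .zero))) := D _ _ _ _ _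
    ProvEquiv _ (.gchoice b (.pchoice r e f) (.pchoice r (.test .zero) (.test .zero))) :=
      (gchoice_args b (left f) (left _)).trans (drop _ _ _ _)
    ProvEquiv _ (.gchoice b (.pchoice r e f) (.test .zero)) := gchoice_args b (refl _) (P1 _ _)
    ProvEquiv _ (.seq (.test b) (.pchoice r e f)) := (test_seq _ _).symm

theorem eq_of_test_seq (b : BExp T) (h : ProvEquiv (.seq (.test b) e) (.seq (.test b) f))
    (h' : ProvEquiv (.seq (.test b.not) e) (.seq (.test b.not) f)) : ProvEquiv e f := by
  have key : ∀ g : Exp T Act Out,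
      ProvEquiv g (.gchoice b (.seq (.test b) g) (.seq (.test b.not) g)) := fun g =>
    (G1 b g).symm.trans ((G2 _ _ _).trans (gchoice_else _ _ _))
  exact ((key e).trans (gchoice_args b h h')).trans (key f).symm

end ProvEquiv

/-! ### Equivalence at an atom -/

section Atoms

variable [Finite T]

/-- A test denoting a single atom. -/
def atomTest (α : At T) : BExp T := (BExp.exists_denotes_atom α).choose

theorem holds_atomTest {α β : At T} : (atomTest α).Holds β ↔ β = α :=
  (BExp.exists_denotes_atom α).choose_spec β

/-- Provable equivalence under the assumption that the atom `α` holds. -/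
def AtEquiv (α : At T) (e f : Exp T Act Out) : Prop :=
  ProvEquiv (.seq (.test (atomTest α)) e) (.seq (.test (atomTest α)) f)

theorem ProvEquiv.atEquiv {e f : Exp T Act Out} (h : ProvEquiv e f) (α : At T) :
    AtEquiv α e f := .seq_congr (.refl _) h

/-- Induction on a finite set of atoms containing those below `b`, splitting off one atom at a time;
the case `b = 1` is the claim. -/
theorem ProvEquiv.of_atEquiv {e f : Exp T Act Out} (h : ∀ α, AtEquiv α e f) : ProvEquiv e f := by
  classical
  cases nonempty_fintype T
  have key : ∀ (s : Finset (At T)) (b : BExp T), (∀ β, b.Holds β → β ∈ s) →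
      ProvEquiv (.seq (.test b) e) (.seq (.test b) f) := by
    intro s
    induction s using Finset.induction_on with
    | empty =>
      intro b hb
      -- A test with no atoms is disjoint from itself, so it reduces everything to `0`.
      have h0 : ∀ g : Exp T Act Out, ProvEquiv (.seq (.test b) g) (.test .zero) := fun g =>
        (test_seq_absorb (c := b) (fun _ h => h) g).trans
          (test_seq_disjoint (fun α hα => by simpa using hb α hα.1) g)
      exact (h0 e).trans (h0 f).symm
    | insert α s _ ih =>
      intro b hb
      refine eq_of_test_seq (atomTest α) ?_ ?_
      · have comm : ∀ g : Exp T Act Out,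
            ProvEquiv (.seq (.test (atomTest α)) (.seq (.test b) g))
              (.seq (.test b) (.seq (.test (atomTest α)) g)) := fun g =>
          (test_seq_test_seq _ _ _).trans ((seq_congr
            (test_congr fun β => by simp [BExp.eval, Bool.and_comm]) (refl g)).trans
              (test_seq_test_seq _ _ _).symm)
        exact ((comm e).trans (seq_congr (refl _) (h α))).trans (comm f).symm
      · have hb' : ∀ β, ((atomTest α).not.and b).Holds β → β ∈ s := by
          intro β hβ
          simp only [BExp.Holds, BExp.eval, Bool.and_eq_true] at hβ
          have h1 : β ≠ α := fun h => (BExp.holds_not _ β).1 hβ.1 (holds_atomTest.2 h)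
          exact (Finset.mem_insert.1 (hb β hβ.2)).resolve_left h1
        exact ((test_seq_test_seq _ _ _).trans (ih _ hb')).trans (test_seq_test_seq _ _ _).symm
  exact ((S1 e).symm.trans (key Finset.univ .one fun β _ => Finset.mem_univ β)).trans (S1 f)

/-- Equivalence at an atom as a setoid. -/
def atSetoid (Act : Type v) (Out : Type w) (α : At T) : Setoid (Exp T Act Out) where
  r := AtEquiv α
  iseqv := ⟨fun _ => .refl _, .symm, .trans⟩

/-- Expressions up to equivalence at an atom. -/
abbrev AtQuot (Act : Type v) (Out : Type w) (α : At T) : Type (max u v w) :=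
  Quotient (atSetoid Act Out α)

theorem AtEquiv.pchoice {α : At T} {e e' f f' : Exp T Act Out} (r : I) (h : AtEquiv α e e')
    (h' : AtEquiv α f f') : AtEquiv α (.pchoice r e f) (.pchoice r e' f') :=
  ((ProvEquiv.test_seq_pchoice _ _ _ _).trans (.pchoice_congr r h h')).trans
    (ProvEquiv.test_seq_pchoice _ _ _ _).symm

/-- Only the left factor may be replaced: after an action in `e` the atom is no longer known to be
`α`. -/
theorem AtEquiv.seq {α : At T} {e e' : Exp T Act Out} (h : AtEquiv α e e') (f : Exp T Act Out) :
    AtEquiv α (.seq e f) (.seq e' f) :=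
  ((ProvEquiv.S3 _ _ _).symm.trans (.seq_congr h (.refl f))).trans (.S3 _ _ _)

/-- The laws are P1 to P4; that the operation is well defined rests on D, through
`test_seq_pchoice`. -/
instance (α : At T) : BarycentricAlgebra (AtQuot Act Out α) where
  comb r := Quotient.map₂ (.pchoice r) fun _ _ h _ _ h' => AtEquiv.pchoice r h h'
  comb_self r := by
    rintro ⟨e⟩
    exact Quotient.sound ((ProvEquiv.P1 r e).atEquiv α)
  comb_one := by
    rintro ⟨e⟩ ⟨f⟩
    exact Quotient.sound ((ProvEquiv.P2 e f).atEquiv α)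
  comb_comm r := by
    rintro ⟨e⟩ ⟨f⟩
    exact Quotient.sound ((ProvEquiv.P3 r e f).atEquiv α)
  comb_assoc r s q := by
    rintro ⟨e⟩ ⟨f⟩ ⟨g⟩ h hq
    exact Quotient.sound ((ProvEquiv.P4 r s q e f g h hq).atEquiv α)

/-- The value of an expression at an atom. -/
def val (α : At T) (e : Exp T Act Out) : Cone (AtQuot Act Out α) :=
  Cone.unit (Quotient.mk (atSetoid Act Out α) e)

variable {α : At T}

theorem val_eq_iff {e f : Exp T Act Out} : val α e = val α f ↔ AtEquiv α e f := by
  unfold val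
  rw [Cone.unit_injective.eq_iff]
  exact Quotient.eq (r := atSetoid Act Out α)

theorem ProvEquiv.val_eq {e f : Exp T Act Out} (h : ProvEquiv e f) : val α e = val α f :=
  val_eq_iff.2 (h.atEquiv α)

theorem ProvEquiv.of_val {e f : Exp T Act Out} (h : ∀ α, val α e = val α f) : ProvEquiv e f :=
  .of_atEquiv fun α => val_eq_iff.1 (h α)

theorem val_pchoice (r : I) (e f : Exp T Act Out) :
    val α (.pchoice r e f) = unitInterval.toNNReal r • val α e +
      unitInterval.toNNReal (σ r) • val α f :=
  Cone.unit_comb r (Quotient.mk (atSetoid Act Out α) e) (Quotient.mk (atSetoid Act Out α) f)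

theorem val_gchoice_pos {b : BExp T} (h : b.Holds α) (e f : Exp T Act Out) :
    val α (.gchoice b e f) = val α e :=
  val_eq_iff.2 (ProvEquiv.test_seq_gchoice_of_le
    (fun β hβ => by rwa [holds_atomTest.1 hβ]) e f)

theorem val_gchoice_neg {b : BExp T} (h : ¬ b.Holds α) (e f : Exp T Act Out) :
    val α (.gchoice b e f) = val α f :=
  val_eq_iff.2 (ProvEquiv.test_seq_gchoice_of_le_not
    (fun β hβ => by rwa [holds_atomTest.1 hβ]) e f)

/-- Right composition with an expression, as a linear map. -/
def seqMap (α : At T) (f : Exp T Act Out) :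
    Cone (AtQuot Act Out α) →ₗ[ℝ≥0] Cone (AtQuot Act Out α) :=
  Cone.map (Quotient.map (fun e => .seq e f) fun _ _ h => AtEquiv.seq h f) (by
    rintro r ⟨e⟩ ⟨g⟩
    exact Quotient.sound ((ProvEquiv.S6 r e g f).atEquiv α))

theorem seqMap_val (f e : Exp T Act Out) : seqMap α f (val α e) = val α (.seq e f) := rfl

theorem val_test_pos {b : BExp T} (h : b.Holds α) :
    val α (.test b : Exp T Act Out) = val α (.test .one) :=
  (ProvEquiv.test_eq_gchoice b).val_eq.trans (val_gchoice_pos h _ _)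

theorem val_test_neg {b : BExp T} (h : ¬ b.Holds α) :
    val α (.test b : Exp T Act Out) = val α (.test .zero) :=
  (ProvEquiv.test_eq_gchoice b).val_eq.trans (val_gchoice_neg h _ _)

theorem val_eq_of_atomTest_seq {e f : Exp T Act Out}
    (h : ProvEquiv (.seq (.test (atomTest α)) e) (.seq (.test (atomTest α)) f)) :
    val α e = val α f := val_eq_iff.2 h

/-- Turns an equality at one atom into an unconditional equivalence of the shape that L5 and L6
require, with `c` the atom test and `g` the expression itself. -/
theorem ProvEquiv.eq_gchoice_atomTest {e f : Exp T Act Out} (h : val α e = val α f) :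
    ProvEquiv e (.gchoice (atomTest α) f e) := by
  refine .of_val fun β => ?_
  by_cases hβ : β = α
  · subst hβ
    rw [val_gchoice_pos (holds_atomTest.2 rfl), h]
  · rw [val_gchoice_neg (mt holds_atomTest.1 hβ)]

/-- A finitely supported family of expressions has a convex combination. -/
theorem exists_val_eq_weightedSum {Y : Type x} (φ : Y → Exp T Act Out) (ν : FinDist Y) :
    ∃ e : Exp T Act Out, ∀ α, val α e = weightedSum ν.weights fun y => val α (φ y) := by
  induction ν using FinDist.induction with
  | single y => exact ⟨φ y, fun α => by simp [weightedSum_single]⟩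
  | mix r ν μ hν hμ =>
    obtain ⟨e, he⟩ := hν
    obtain ⟨f, hf⟩ := hμ
    exact ⟨.pchoice r e f, fun α => by rw [val_pchoice, weightedSum_mix, he, hf]⟩

/-! ### The fundamental theorem -/

/-- The expression that performs a given outcome. -/
def outcomeExp : Outcome Act Out (Exp T Act Out) → Exp T Act Out
  | Sum.inl .reject => .test .zero
  | Sum.inl .accept => .test .one
  | Sum.inl (.ret v) => .ret v
  | Sum.inr (p, e) => .seq (.act p) e

/-- The value at `α` of a weighted sum of outcomes. -/
def outcomeSum (α : At T) (w : Outcome Act Out (Exp T Act Out) →₀ ℝ) : Cone (AtQuot Act Out α) :=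
  weightedSum w fun d => val α (outcomeExp d)

theorem outcomeSum_single (d : Outcome Act Out (Exp T Act Out)) :
    outcomeSum α (StdSimplex.single d : Behaviour T Act Out).weights = val α (outcomeExp d) := by
  simp [outcomeSum, weightedSum_single]

/-- The cases are S4, S1, S7 and S3. Only acceptance runs `f` at the same atom, so only that case
needs `h`. -/
theorem outcomeSum_seqOutcome (f : Exp T Act Out) {ν : Behaviour T Act Out}
    (h : val α f = outcomeSum α ν.weights) (d : Outcome Act Out (Exp T Act Out)) :
    outcomeSum α (seqOutcome f ν d).weights = val α (.seq (outcomeExp d) f) := by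
  rcases d with (_ | _ | v) | ⟨p, e⟩
  · exact (outcomeSum_single _).trans (ProvEquiv.S4 f).symm.val_eq
  · exact h.symm.trans (ProvEquiv.S1 f).symm.val_eq
  · exact (outcomeSum_single _).trans (ProvEquiv.S7 v f).symm.val_eq
  · exact (outcomeSum_single _).trans (ProvEquiv.S3 _ e f).symm.val_eq

/-- Acceptance is excluded because `appendTo` keeps it as `1`, whereas `1; l` is `l`. -/
theorem val_outcomeExp_appendTo (l : Exp T Act Out) {d : Outcome Act Out (Exp T Act Out)}
    (hd : d ≠ Sum.inl .accept) :
    val α (outcomeExp (appendTo l d)) = val α (.seq (outcomeExp d) l) := by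
  rcases d with (_ | _ | v) | ⟨p, e⟩
  · exact (ProvEquiv.S4 l).symm.val_eq
  · exact absurd rfl hd
  · exact (ProvEquiv.S7 v l).symm.val_eq
  · exact (ProvEquiv.S3 _ e l).symm.val_eq

/-! ### Loops and the removal of immediate acceptance -/

theorem erase_weights_nonneg {Y : Type x} (ν : FinDist Y) (y : Y) : 0 ≤ ν.weights.erase y := by
  classical
  intro z
  rw [Finsupp.erase_apply]
  split
  · exact le_rfl
  · exact ν.nonneg z

theorem sum_erase_weights {Y : Type x} (ν : FinDist Y) (y : Y) :
    (ν.weights.erase y).sum (fun _ a => a) = 1 - ν.weights y := by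
  have h := ν.total
  rw [← Finsupp.single_add_erase y ν.weights, Finsupp.sum_add_index' (by simp) (by simp),
    Finsupp.sum_single_index rfl] at h
  linarith

/-- Linearity of weighted sums brings the semantic side to the shape that L5 and L6 give: an exit
term plus the non-accepting part of the body followed by `l`. -/
theorem outcomeSum_loopDist {r : I} {ν : Behaviour T Act Out}
    (h : 1 - (r : ℝ) * ν.weights (Sum.inl .accept) ≠ 0) (l : Exp T Act Out) :
    outcomeSum α (loopDist r ν l).weights =
      (1 - (r : ℝ) * ν.weights (Sum.inl .accept))⁻¹.toNNReal •
        (unitInterval.toNNReal (σ r) • val α (.test .one) +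
          unitInterval.toNNReal r •
            seqMap α l (outcomeSum α (ν.weights.erase (Sum.inl .accept)))) := by
  classical
  have hr : 0 ≤ 1 - (r : ℝ) := sub_nonneg.2 r.2.2
  have hc : 0 ≤ 1 - (r : ℝ) * ν.weights (Sum.inl .accept) := by
    rw [← loopWeights_total r ν l]
    exact Finsupp.sum_nonneg fun d _ => loopWeights_nonneg r ν l d
  have hm := erase_weights_nonneg ν (Sum.inl .accept)
  unfold loopDist outcomeSum
  rw [dif_neg h]
  dsimp only
  rw [weightedSum_smul (inv_nonneg.2 hc)]
  unfold loopWeights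
  rw [weightedSum_add (Finsupp.single_nonneg.2 hr)
      (smul_nonneg r.2.1 (Finsupp.mapDomain_nonneg hm)),
    weightedSum_single, weightedSum_smul r.2.1, weightedSum_mapDomain hm, map_weightedSum]
  congr 3
  · exact Real.toNNReal_of_nonneg _
  · exact Real.toNNReal_of_nonneg _
  · refine weightedSum_congr fun d hd => val_outcomeExp_appendTo l ?_
    rintro rfl
    simp at hd

/-- The part of an expression that does not accept immediately. -/
theorem exists_productive_part {e : Exp T Act Out} {ν : Behaviour T Act Out}
    (he : val α e = outcomeSum α ν.weights) :
    ∃ (s : I) (f : Exp T Act Out), (s : ℝ) = 1 - ν.weights (Sum.inl .accept) ∧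
      val α e = val α (.pchoice s f (.test .one)) ∧
      unitInterval.toNNReal s • val α f =
        outcomeSum α (ν.weights.erase (Sum.inl .accept)) := by
  have hm := erase_weights_nonneg ν (Sum.inl .accept)
  have hsum := sum_erase_weights ν (Sum.inl .accept)
  have ht : 0 ≤ 1 - ν.weights (Sum.inl .accept) := by
    rw [← hsum]
    exact Finsupp.sum_nonneg fun d _ => hm d
  let s : I := ⟨1 - ν.weights (Sum.inl .accept), ht, sub_le_self _ (ν.nonneg _)⟩
  have key : ∃ f : Exp T Act Out, unitInterval.toNNReal s • val α f =
      outcomeSum α (ν.weights.erase (Sum.inl .accept)) := by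
    rcases ht.eq_or_lt with h0 | hpos
    -- The body accepts with probability one, so `f` has weight zero and any expression serves.
    · refine ⟨.test .zero, ?_⟩
      have hs : unitInterval.toNNReal s = 0 := by ext; exact h0.symm
      have hz : ν.weights.erase (Sum.inl .accept) = 0 := by
        rw [← h0] at hsum
        have := (Finset.sum_eq_zero_iff_of_nonneg fun d _ => hm d).1 hsum
        ext d
        by_contra hd
        exact hd (this d (Finsupp.mem_support_iff.2 hd))
      rw [hs, hz, zero_smul]
      exact (weightedSum_zero _).symm
    -- Otherwise the non-accepting outcomes, normalised to a distribution, are realised by an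
    -- expression.
    · let μ : Behaviour T Act Out :=
        { weights := (1 - ν.weights (Sum.inl .accept))⁻¹ • ν.weights.erase (Sum.inl .accept)
          nonneg := smul_nonneg (inv_nonneg.2 ht) hm
          total := by
            rw [Finsupp.sum_smul_index (by simp), ← Finsupp.mul_sum, hsum,
              inv_mul_cancel₀ hpos.ne'] }
      obtain ⟨f, hf⟩ := exists_val_eq_weightedSum outcomeExp μ
      refine ⟨f, ?_⟩
      have hs : unitInterval.toNNReal s *
          (1 - ν.weights (Sum.inl .accept))⁻¹.toNNReal = 1 := by
        ext
        rw [NNReal.coe_mul, Real.coe_toNNReal _ (inv_nonneg.2 ht)]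
        exact mul_inv_cancel₀ hpos.ne'
      rw [hf, weightedSum_smul (inv_nonneg.2 ht), smul_smul, hs, one_smul]
      rfl
  obtain ⟨f, hf⟩ := key
  refine ⟨s, f, rfl, ?_, hf⟩
  have hs : (ν.weights (Sum.inl .accept)).toNNReal = unitInterval.toNNReal (σ s) := by
    ext
    rw [Real.coe_toNNReal _ (ν.nonneg _)]
    simp [s]
  rw [val_pchoice, hf, he, add_comm, ← hs]
  exact weightedSum_erase_add ν.nonneg _ _

/-- Since the body is `1` at `α`, it can be written `e +_c 1` with `c` the negated atom test. L3
replaces it by `c; e`, which fails at `α` once the loop is unrolled by L1. -/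
theorem val_gloop_diverge {b : BExp T} {e : Exp T Act Out} (hb : b.Holds α)
    (he : val α e = val α (.test .one)) : val α (.gloop b e) = val α (.test .zero) := by
  have h1 : ProvEquiv e (.gchoice (atomTest α).not e (.test .one)) := by
    refine .of_val fun β => ?_
    by_cases hβ : β = α
    · subst hβ
      rw [val_gchoice_neg (by rw [BExp.holds_not, not_not]; exact holds_atomTest.2 rfl), he]
    · rw [val_gchoice_pos ((BExp.holds_not _ β).2 (mt holds_atomTest.1 hβ))]
  have h2 := (ProvEquiv.gloop_congr (fun _ => rfl : b.BAEquiv b) h1).trans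
    ((ProvEquiv.L3 _ _ _).trans (.L1 _ _))
  rw [h2.val_eq, val_gchoice_pos hb, ← seqMap_val, ← seqMap_val, val_test_neg, seqMap_val,
    (ProvEquiv.S4 e).val_eq, seqMap_val, (ProvEquiv.S4 _).val_eq]
  rw [BExp.holds_not, not_not]
  exact holds_atomTest.2 rfl

theorem val_eq_one_of_accept {e : Exp T Act Out} {ν : Behaviour T Act Out}
    (he : val α e = outcomeSum α ν.weights) (h : ν.weights (Sum.inl .accept) = 1) :
    val α e = val α (.test .one) := by
  obtain ⟨s, f, hs, hef, -⟩ := exists_productive_part he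
  obtain rfl : s = 0 := by ext; rw [hs, h]; simp
  rw [hef, val_pchoice]
  simp

/-- L5 leaves one run of `f` followed by the loop. The weight `s` of `f` in the body is exactly what
the normalising factor `1 / s` of `loopDist` cancels. -/
theorem val_gloop {b : BExp T} {e : Exp T Act Out} {ν : Behaviour T Act Out} (hb : b.Holds α)
    (he : val α e = outcomeSum α ν.weights) :
    val α (.gloop b e) = outcomeSum α (loopDist 1 ν (.gloop b e)).weights := by
  by_cases h : 1 - ((1 : I) : ℝ) * ν.weights (Sum.inl .accept) = 0
  · rw [loopDist_diverge h, outcomeSum_single]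
    refine val_gloop_diverge hb (val_eq_one_of_accept he ?_)
    rw [Set.Icc.coe_one] at h
    linarith
  obtain ⟨s, f, hs, hef, hf⟩ := exists_productive_part he
  have hs' : (s : ℝ) = 1 - ((1 : I) : ℝ) * ν.weights (Sum.inl .accept) := by simp [hs]
  have hs0 : (0 : ℝ) < s := lt_of_le_of_ne s.2.1 (by rw [hs']; exact Ne.symm h)
  have hc : (s : ℝ)⁻¹.toNNReal * unitInterval.toNNReal s = 1 := by
    ext
    rw [NNReal.coe_mul, Real.coe_toNNReal _ (inv_nonneg.2 s.2.1)]
    exact inv_mul_cancel₀ hs0.ne'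
  rw [outcomeSum_loopDist h, ← hf, ← hs',
    val_eq_of_atomTest_seq (ProvEquiv.L5 (ProvEquiv.eq_gchoice_atomTest hef) hs0),
    val_gchoice_pos hb]
  simp [smul_smul, hc, seqMap_val]

theorem val_ploop (r : I) {e : Exp T Act Out} {ν : Behaviour T Act Out}
    (he : val α e = outcomeSum α ν.weights) :
    val α (.ploop r e) = outcomeSum α (loopDist r ν (.ploop r e)).weights := by
  obtain ⟨s, f, hs, hef, hf⟩ := exists_productive_part he
  have hst : ν.weights (Sum.inl .accept) = 1 - s := by rw [hs]; ring
  by_cases h : 1 - (r : ℝ) * ν.weights (Sum.inl .accept) = 0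
  · have hr := r.2.2
    have hr0 := r.2.1
    have hs0 := s.2.1
    rw [hst] at h
    -- Divergence `r (1 - s) = 1` forces `s = 0` and `r = 1`, so L4 reduces to a guarded loop with
    -- guard `1`.
    have hs1 : (s : ℝ) = 0 := by nlinarith [s.2.2]
    obtain rfl : r = 1 := by ext; rw [hs1] at h; rw [Set.Icc.coe_one]; linarith
    rw [loopDist_diverge (by rw [hst]; exact h), outcomeSum_single,
      ← (ProvEquiv.L4 e).val_eq]
    exact val_gloop_diverge rfl (val_eq_one_of_accept he (by rw [hst, hs1]; ring))
  have hd : (1 : ℝ) - r * (1 - s) ≠ 0 := by rwa [← hst]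
  have hd0 : 0 ≤ (1 : ℝ) - r * (1 - s) := by nlinarith [r.2.1, r.2.2, s.2.1, s.2.2]
  -- The parameter of L6. It is at most one since `r s ≤ 1 - r + r s`, and its complement is the
  -- exit probability of `loopDist`.
  let q : I := ⟨r * s / (1 - r * (1 - s)), div_nonneg (mul_nonneg r.2.1 s.2.1) hd0, by
    rw [div_le_one (lt_of_le_of_ne hd0 hd.symm)]
    linarith [r.2.2]⟩
  rw [outcomeSum_loopDist h, ← hf,
    val_eq_of_atomTest_seq (ProvEquiv.L6 q (ProvEquiv.eq_gchoice_atomTest hef) hd rfl),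
    val_pchoice, map_smul, seqMap_val, smul_add, smul_smul, smul_smul, smul_smul, add_comm, hst]
  congr 2
  · ext
    rw [NNReal.coe_mul, Real.coe_toNNReal _ (inv_nonneg.2 hd0)]
    simp only [unitInterval.coe_toNNReal, unitInterval.coe_symm_eq, q]
    field_simp
    ring
  · ext
    rw [NNReal.coe_mul, NNReal.coe_mul, Real.coe_toNNReal _ (inv_nonneg.2 hd0)]
    simp only [unitInterval.coe_toNNReal, q]
    field_simp

/-- The fundamental theorem: an expression is the sum of its derivatives. -/
theorem val_eq_outcomeSum_derivative (e : Exp T Act Out) :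
    val α e = outcomeSum α (derivative α e).weights := by
  induction e with
  | act p =>
    simp only [derivative, outcomeSum_single]
    exact (ProvEquiv.S2 _).symm.val_eq
  | test b =>
    by_cases h : b.Holds α
    · simp only [derivative, h, if_true, outcomeSum_single, outcomeExp, val_test_pos]
    · simp only [derivative, h, if_false, outcomeSum_single, outcomeExp, val_test_neg h]
  | ret v => simp only [derivative, outcomeSum_single, outcomeExp]
  | gchoice b e f ihe ihf =>
    by_cases h : b.Holds α
    · simp only [derivative, h, if_true, val_gchoice_pos, ihe]
    · simp only [derivative, h, if_false, val_gchoice_neg h, ihf]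
  | pchoice r e f ihe ihf =>
    rw [val_pchoice, ihe, ihf]
    exact (weightedSum_mix _ _ _ _).symm
  | seq e f ihe ihf =>
    rw [← seqMap_val, ihe]
    -- As `seqMap` is linear, composition with `f` acts on each outcome separately.
    unfold outcomeSum
    rw [map_weightedSum]
    simp only [derivative]
    rw [weightedSum_iConvexComb]
    exact weightedSum_congr fun d _ => (outcomeSum_seqOutcome f ihf d).symm
  | gloop b e ih =>
    by_cases h : b.Holds α
    · simp only [derivative, h, if_true]
      exact val_gloop h ih
    · simp only [derivative, h, if_false, outcomeSum_single, outcomeExp]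
      rw [(ProvEquiv.L1 b e).val_eq, val_gchoice_neg h]
  | ploop r e ih => exact val_ploop r ih

end Atoms

/-! ### Finiteness of the reachable states -/

/-- A set of expressions closed under derivatives. -/
def DerivClosed (S : Set (Exp T Act Out)) : Prop :=
  ∀ e ∈ S, ∀ (α : At T) (p : Act) (e' : Exp T Act Out),
    (derivative α e).weights (Sum.inr (p, e')) ≠ 0 → e' ∈ S

theorem seqOutcome_step_ne_zero {f g : Exp T Act Out} {ν : Behaviour T Act Out} {p : Act}
    {d : Outcome Act Out (Exp T Act Out)} (h : (seqOutcome f ν d).weights (Sum.inr (p, g)) ≠ 0) :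
    ν.weights (Sum.inr (p, g)) ≠ 0 ∨ ∃ e', d = Sum.inr (p, e') ∧ g = .seq e' f := by
  classical
  rcases d with (_ | _ | v) | ⟨p', e'⟩
  · simp [seqOutcome] at h
  · exact .inl h
  · simp [seqOutcome] at h
  · simp only [seqOutcome, StdSimplex.weights_single, Finsupp.single_apply, ne_eq,
      ite_eq_right_iff, Sum.inr.injEq, Prod.mk.injEq, one_ne_zero, imp_false, not_not] at h
    exact .inr ⟨e', by rw [h.1], h.2.symm⟩

theorem derivative_seq_step_ne_zero {α : At T} {e f g : Exp T Act Out} {p : Act}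
    (h : (derivative α (.seq e f)).weights (Sum.inr (p, g)) ≠ 0) :
    (derivative α f).weights (Sum.inr (p, g)) ≠ 0 ∨
      ∃ e', (derivative α e).weights (Sum.inr (p, e')) ≠ 0 ∧ g = .seq e' f := by
  simp only [derivative] at h
  rw [FinDist.weights_iConvexComb, Finsupp.sum, Finsupp.finsetSum_apply] at h
  obtain ⟨d, hd, hd'⟩ := Finset.exists_ne_zero_of_sum_ne_zero h
  rw [Finsupp.smul_apply, smul_eq_mul] at hd'
  rcases seqOutcome_step_ne_zero (right_ne_zero_of_mul hd') with h1 | ⟨e', rfl, hg⟩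
  · exact .inl h1
  · exact .inr ⟨e', left_ne_zero_of_mul hd', hg⟩

theorem loopDist_step_ne_zero {r : I} {ν : Behaviour T Act Out} {l g : Exp T Act Out} {p : Act}
    (h : (loopDist r ν l).weights (Sum.inr (p, g)) ≠ 0) :
    ∃ e', ν.weights (Sum.inr (p, e')) ≠ 0 ∧ g = .seq e' l := by
  obtain ⟨e', rfl⟩ : ∃ e', g = .seq e' l := by
    by_contra! hg
    exact h (loopDist_other p g hg)
  refine ⟨e', fun h0 => h ?_, rfl⟩
  by_cases hd : 1 - (r : ℝ) * ν.weights (Sum.inl Halt.accept) = 0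
  · simp [loopDist_diverge hd]
  · simp [loopDist_step hd, h0]

/-- Successors of `l` have the form `e'; l`. If `e'` accepts, `e'; l` steps as `l` does, again to
such a state, so `l` and the states `g; l` with `g ∈ S` form a closed set. -/
theorem exists_finite_derivClosed_loop {e l : Exp T Act Out} {S : Set (Exp T Act Out)}
    (hfin : S.Finite) (he : e ∈ S) (hS : DerivClosed S)
    (hl : ∀ α p g, (derivative α l).weights (Sum.inr (p, g)) ≠ 0 →
      ∃ e', (derivative α e).weights (Sum.inr (p, e')) ≠ 0 ∧ g = .seq e' l) :
    ∃ S : Set (Exp T Act Out), S.Finite ∧ l ∈ S ∧ DerivClosed S := by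
  have hl' : ∀ α p g, (derivative α l).weights (Sum.inr (p, g)) ≠ 0 →
      g ∈ (fun e' => Exp.seq e' l) '' S := by
    intro α p g h
    obtain ⟨e', h1, rfl⟩ := hl α p g h
    exact ⟨e', hS e he α p e' h1, rfl⟩
  refine ⟨insert l ((fun e' => Exp.seq e' l) '' S), (hfin.image _).insert l,
    Set.mem_insert _ _, ?_⟩
  rintro _ (rfl | ⟨g, hg, rfl⟩) α p g' h
  · exact .inr (hl' α p g' h)
  · rcases derivative_seq_step_ne_zero h with h1 | ⟨e', h1, rfl⟩
    · exact .inr (hl' α p g' h1)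
    · exact .inr ⟨e', hS g hg α p e' h1, rfl⟩

theorem exists_finite_derivClosed_of_step {e : Exp T Act Out} {S : Set (Exp T Act Out)}
    (hfin : S.Finite) (hS : DerivClosed S)
    (h : ∀ α p g, (derivative α e).weights (Sum.inr (p, g)) ≠ 0 → g ∈ S) :
    ∃ S : Set (Exp T Act Out), S.Finite ∧ e ∈ S ∧ DerivClosed S := by
  refine ⟨insert e S, hfin.insert e, Set.mem_insert _ _, ?_⟩
  rintro _ (rfl | hg) α p g' h'
  · exact .inr (h α p g' h')
  · exact .inr (hS _ hg α p g' h')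

theorem DerivClosed.union {S S' : Set (Exp T Act Out)} (hS : DerivClosed S)
    (hS' : DerivClosed S') : DerivClosed (S ∪ S') := by
  rintro e (he | he) α p e' h
  · exact .inl (hS e he α p e' h)
  · exact .inr (hS' e he α p e' h)

theorem exists_finite_derivClosed (e : Exp T Act Out) :
    ∃ S : Set (Exp T Act Out), S.Finite ∧ e ∈ S ∧ DerivClosed S := by
  have hempty : DerivClosed (∅ : Set (Exp T Act Out)) := fun _ h => h.elim
  have htest : ∀ b, ∃ S : Set (Exp T Act Out), S.Finite ∧ .test b ∈ S ∧ DerivClosed S := fun b =>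
    exists_finite_derivClosed_of_step Set.finite_empty hempty fun α p g h => by
      simp [derivative] at h
  induction e with
  | act p =>
    obtain ⟨S, hfin, h1, hS⟩ := htest .one
    refine exists_finite_derivClosed_of_step hfin hS fun α q g h => ?_
    classical
    simp only [derivative, StdSimplex.weights_single, Finsupp.single_apply, ne_eq,
      ite_eq_right_iff, Sum.inr.injEq, Prod.mk.injEq, one_ne_zero, imp_false, not_not] at h
    rwa [← h.2]
  | test b => exact htest b
  | ret v =>
    exact exists_finite_derivClosed_of_step Set.finite_empty hempty fun α p g h => by
      simp [derivative] at h
  | gchoice b e f ihe ihf =>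
    obtain ⟨S, hfin, he, hS⟩ := ihe
    obtain ⟨S', hfin', hf, hS'⟩ := ihf
    refine exists_finite_derivClosed_of_step (hfin.union hfin') (hS.union hS')
      fun α p g h => ?_
    simp only [derivative] at h
    split at h
    · exact .inl (hS e he α p g h)
    · exact .inr (hS' f hf α p g h)
  | pchoice r e f ihe ihf =>
    obtain ⟨S, hfin, he, hS⟩ := ihe
    obtain ⟨S', hfin', hf, hS'⟩ := ihf
    refine exists_finite_derivClosed_of_step (hfin.union hfin') (hS.union hS')
      fun α p g h => ?_
    simp only [derivative, mix, StdSimplex.weights_convexCombPair, Finsupp.add_apply,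
      Finsupp.smul_apply, smul_eq_mul] at h
    by_cases h1 : (derivative α e).weights (Sum.inr (p, g)) = 0
    · refine .inr (hS' f hf α p g fun h2 => h ?_)
      rw [h1, h2]
      ring
    · exact .inl (hS e he α p g h1)
  | seq e f ihe ihf =>
    obtain ⟨S, hfin, he, hS⟩ := ihe
    obtain ⟨S', hfin', hf, hS'⟩ := ihf
    refine ⟨(fun e' => Exp.seq e' f) '' S ∪ S', (hfin.image _).union hfin',
      .inl ⟨e, he, rfl⟩, ?_⟩
    rintro _ (⟨g, hg, rfl⟩ | hg) α p g' h
    · rcases derivative_seq_step_ne_zero h with h1 | ⟨e', h1, rfl⟩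
      · exact .inr (hS' f hf α p g' h1)
      · exact .inl ⟨e', hS g hg α p e' h1, rfl⟩
    · exact .inr (hS' _ hg α p g' h)
  | gloop b e ih =>
    obtain ⟨S, hfin, he, hS⟩ := ih
    refine exists_finite_derivClosed_loop hfin he hS fun α p g h => ?_
    simp only [derivative] at h
    split at h
    · exact loopDist_step_ne_zero h
    · simp at h
  | ploop r e ih =>
    obtain ⟨S, hfin, he, hS⟩ := ih
    exact exists_finite_derivClosed_loop hfin he hS fun α p g h => loopDist_step_ne_zero h

/-! ### Homomorphisms and weighted sums -/

/-- The action of a map on outcomes. -/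
def Outcome.map {X : Type x} {Y : Type y} (f : X → Y) : Outcome Act Out X → Outcome Act Out Y :=
  Sum.map id (Prod.map id f)

theorem mapDomain_apply_eq_sum_filter {Y : Type x} {Z : Type y} [DecidableEq Z]
    (f : Y → Z) (w : Y →₀ ℝ) (z : Z) :
    w.mapDomain f z = ∑ a ∈ w.support with f a = z, w a := by
  rw [Finsupp.mapDomain, Finsupp.sum, Finsupp.finsetSum_apply, Finset.sum_filter]
  exact Finset.sum_congr rfl fun a _ => Finsupp.single_apply

/-- Both homomorphism clauses become one push-forward, so `weightedSum_mapDomain` can change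
variables. -/
theorem IsHom.weights_eq {X : Type x} {Y : Type y} {β : Automaton T Act Out X}
    {γ : Automaton T Act Out Y} {f : X → Y} (h : IsHom β γ f) (s : X) (α : At T) :
    (γ (f s) α).weights = (β s α).weights.mapDomain (Outcome.map f) := by
  classical
  ext d
  rw [mapDomain_apply_eq_sum_filter]
  rcases d with o | ⟨p, t⟩
  · rw [h.halt, Finset.sum_filter, Finset.sum_eq_single (Sum.inl o)]
    · simp [Outcome.map]
    · rintro (o' | ⟨p, t⟩) _ hne
      · rw [if_neg (by simpa [Outcome.map] using hne)]
      · rw [if_neg (by simp [Outcome.map])]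
    · intro ho
      simpa [Outcome.map] using ho
  · rw [h.step, FinDist.mass]
    refine Finset.sum_congr (Finset.filter_congr ?_) fun _ _ => rfl
    rintro (o' | ⟨p', t'⟩) _
    · simp [Outcome.map]
    · simp only [Set.mem_ofPred_eq, Outcome.map, Sum.map_inr, Prod.map_apply, id_eq,
        Sum.inr.injEq, Prod.mk.injEq]
      exact ⟨fun ⟨s', h1, h2, h3⟩ => ⟨h2, by rw [h3, h1]⟩, fun ⟨h1, h2⟩ => ⟨t', h2, h1, rfl⟩⟩

/-- Weights are non-negative, so a positive one cannot cancel under push-forward. -/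
theorem IsHom.step_ne_zero {X : Type x} {Y : Type y} {β : Automaton T Act Out X}
    {γ : Automaton T Act Out Y} {f : X → Y} (h : IsHom β γ f) {s : X} {α : At T} {p : Act}
    {t : X} (ht : (β s α).weights (Sum.inr (p, t)) ≠ 0) :
    (γ (f s) α).weights (Sum.inr (p, f t)) ≠ 0 := by
  classical
  rw [h.weights_eq, mapDomain_apply_eq_sum_filter]
  refine (Finset.sum_pos' (fun d _ => (β s α).nonneg d) ⟨Sum.inr (p, t), ?_, ?_⟩).ne'
  · exact Finset.mem_filter.2 ⟨Finsupp.mem_support_iff.2 ht, rfl⟩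
  · exact lt_of_le_of_ne ((β s α).nonneg _) ht.symm

/-! ### The system of equations of a finite automaton -/

section Systems

variable {X : Type x}

/-- The right-hand side contributed by an outcome, where `ι` numbers the states. -/
def outcomeSys {Y : Type y} (ι : Y → Option X) : Outcome Act Out Y → PSys T Act Out X
  | Sum.inl .reject => .const (.test .zero)
  | Sum.inl .accept => .const (.test .one)
  | Sum.inl (.ret v) => .const (.ret v)
  | Sum.inr (p, s) => (ι s).elim (.const (.act p)) (.var (.act p))

theorem outcomeSys_guarded {Y : Type y} (ι : Y → Option X) (d : Outcome Act Out Y) :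
    (outcomeSys ι d : PSys T Act Out X).Guarded := by
  rcases d with (_ | _ | v) | ⟨p, s⟩ <;> try trivial
  simp only [outcomeSys]
  cases ι s
  · trivial
  · exact fun α => rfl

variable [Finite T]

/-- The term is chosen before `h`, which lets one system serve both projections. -/
theorem exists_psys_val_eq_weightedSum {Y : Type y} (φ : Y → PSys T Act Out X)
    (hφ : ∀ y, (φ y).Guarded) (ν : FinDist Y) :
    ∃ p : PSys T Act Out X, p.Guarded ∧ ∀ (h : X → Exp T Act Out) α,
      val α (p.subst h) = weightedSum ν.weights fun y => val α ((φ y).subst h) := by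
  induction ν using FinDist.induction with
  | single y => exact ⟨φ y, hφ y, fun h α => by simp [weightedSum_single]⟩
  | mix r ν μ hν hμ =>
    obtain ⟨p, hp, hp'⟩ := hν
    obtain ⟨q, hq, hq'⟩ := hμ
    exact ⟨.pchoice r p q, ⟨hp, hq⟩, fun h α => by
      rw [PSys.subst, val_pchoice, weightedSum_mix, hp', hq']⟩

/-- A cascade of guarded choices on atom tests selects `p α`; guards stay outside probabilistic
choices, as the grammar of `Sys` demands. -/
theorem exists_sys_val_eq (p : At T → PSys T Act Out X) (hp : ∀ α, (p α).Guarded) :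
    ∃ e : Sys T Act Out X, e.Guarded ∧ ∀ (h : X → Exp T Act Out) α,
      val α (e.subst h) = val α ((p α).subst h) := by
  classical
  cases nonempty_fintype T
  have key : ∀ s : Finset (At T), ∃ e : Sys T Act Out X, e.Guarded ∧
      ∀ (h : X → Exp T Act Out), ∀ α ∈ s, val α (e.subst h) = val α ((p α).subst h) := by
    intro s
    induction s using Finset.induction_on with
    | empty => exact ⟨.prob (.const (.test .zero)), trivial, by simp⟩
    | insert β s _ ih =>
      obtain ⟨e, he, he'⟩ := ih
      refine ⟨.gchoice (atomTest β) (.prob (p β)) e, ⟨hp β, he⟩, fun h α hα => ?_⟩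
      rw [Sys.subst]
      by_cases hαβ : α = β
      · subst hαβ
        exact val_gchoice_pos (holds_atomTest.2 rfl) _ _
      · rw [val_gchoice_neg (mt holds_atomTest.1 hαβ)]
        exact he' h α ((Finset.mem_insert.1 hα).resolve_left hαβ)
  obtain ⟨e, he, he'⟩ := key Finset.univ
  exact ⟨e, he, fun h α => he' h α (Finset.mem_univ α)⟩

/-- States of an automaton that map to expressions by a homomorphism, and from which only finitely
many states are reachable, form solutions of a Salomaa system that depends on the automaton only. -/
theorem exists_salomaa_system {Y : Type y} (ρ : Automaton T Act Out Y) (S : Set Y)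
    (hS : ∀ s ∈ S, ∀ α p t, (ρ s α).weights (Sum.inr (p, t)) ≠ 0 → t ∈ S) (c : S ≃ X) :
    ∃ τ : X → Sys T Act Out X, IsSalomaa τ ∧ ∀ f : Y → Exp T Act Out,
      IsHom ρ brzozowski f → IsSolution UAEquiv τ fun i => f (c.symm i) := by
  classical
  -- States outside `S` have no indeterminate. The term `outcomeSys` assigns them is immaterial, as
  -- they are reached from `S` with probability zero.
  let ι : Y → Option X := fun s => if h : s ∈ S then some (c ⟨s, h⟩) else none
  choose p hp hp' using fun (i : X) (α : At T) =>
    exists_psys_val_eq_weightedSum (outcomeSys ι) (outcomeSys_guarded (T := T) ι)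
      (ρ (c.symm i) α)
  choose τ hτ hτ' using fun i : X => exists_sys_val_eq (p i) (hp i)
  refine ⟨τ, hτ, fun f hf i => .of_equiv (.of_val fun α => ?_)⟩
  -- The fundamental theorem expands the image expression into outcomes, and the homomorphism pulls
  -- that sum back to the outcomes of `ρ`, where it is compared term by term.
  rw [hτ', hp', val_eq_outcomeSum_derivative, outcomeSum,
    show (derivative α (f (c.symm i))).weights = _ from hf.weights_eq (c.symm i) α,
    weightedSum_mapDomain (ρ _ α).nonneg]
  refine weightedSum_congr fun d hd => ?_
  rcases d with (_ | _ | v) | ⟨q, s⟩ <;> try rfl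
  have hs : s ∈ S := hS _ (c.symm i).2 α q s hd
  simp [Outcome.map, outcomeExp, outcomeSys, ι, hs, PSys.subst]

end Systems

end ProbGKAT

end

/-! ### Completeness -/

theorem mainTheorem1 {T Act Out : Type*} [Finite T] (e f : ProbGKAT.Exp T Act Out)
    (h : ProbGKAT.Bisimilar ProbGKAT.brzozowski ProbGKAT.brzozowski e f) :
    ProbGKAT.UAEquiv e f := by
  obtain ⟨R, ⟨ρ, h₁, h₂⟩, hR⟩ := h
  obtain ⟨S₁, hfin₁, he, hS₁⟩ := ProbGKAT.exists_finite_derivClosed e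
  obtain ⟨S₂, hfin₂, hf, hS₂⟩ := ProbGKAT.exists_finite_derivClosed f
  -- The relation itself may be infinite; the pairs with both components in the finite closed sets
  -- are closed under transitions.
  let S : Set {q : ProbGKAT.Exp T Act Out × ProbGKAT.Exp T Act Out // R q.1 q.2} :=
    {q | q.1.1 ∈ S₁ ∧ q.1.2 ∈ S₂}
  have hfin : S.Finite :=
    ((hfin₁.prod hfin₂).preimage Subtype.val_injective.injOn).subset fun q hq => hq
  have hS : ∀ s ∈ S, ∀ α p t, (ρ s α).weights (Sum.inr (p, t)) ≠ 0 → t ∈ S :=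
    fun s hs α p t ht => ⟨hS₁ _ hs.1 α p _ (h₁.step_ne_zero ht),
      hS₂ _ hs.2 α p _ (h₂.step_ne_zero ht)⟩
  have := hfin.to_subtype
  -- `UAEquiv.ua` wants indeterminates in `Type`, while `S` may live in a higher universe, so its
  -- elements are numbered.
  let c := Finite.equivFin S
  obtain ⟨τ, hτ, hsol⟩ := ProbGKAT.exists_salomaa_system ρ S hS c
  have key := ProbGKAT.UAEquiv.ua τ _ _ hτ (hsol _ h₁) (hsol _ h₂) (c ⟨⟨(e, f), hR⟩, he, hf⟩)
  rwa [c.symm_apply_apply] at key
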